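/- Let $m\ge 1$ be an integer and $\lambda_1,\dots,\lambda_m\in(0,1)$. Write $r^2=|z_1|^2+\dots+|z_m|^2$ on $\mathbb C^m$, let $J$ be the standard complex structure, put $d^c f=-df\circ J$ (so $dd^c=2i\partial\bar\partial$), and let $S^{2m-1}=\{r=1\}$. Let $\xi'=i\sum_a\lambda_a\bigl(z_a\frac{\partial}{\partial z_a}-\bar z_a\frac{\partial}{\partial\bar z_a}\bigr)$, so that $-J\xi'$ has the flow $(t,z)\mapsto(e^{\lambda_1t}z_1,\dots,e^{\lambda_mt}z_m)$. Let $F:\mathbb C^m\setminus\{0\}\to(0,\infty)\times S^{2m-1}$ be the unique bijection which satisfies $F(w)=(1,w)$ for $w\in S^{2m-1}$ and which is equivariant under the flow of $-J\xi'$ on the domain and the flow $(t;s,w)\mapsto(e^ts,w)$ on the codomain. Define $r_\lambda:\mathbb C^m\setminus\{0\}\to(0,\infty)$ to be the first component of $F$; it is the radius function of the Kähler cone whose link is the sphere with the Sasakian structure deformed to have Reeb field $\xi'$. A $C^\infty$ function $f:Y\to\mathbb R$ on an open set $Y\subseteq\mathbb C^m$ is called strictly plurisubharmonic if $dd^cf(v,Jv)>0$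 for every nonzero tangent vector $v$ at every point of $Y$. A Kähler form on $Y$ is a closed $C^\infty$ real $(1,1)$-form $\omega$ on $Y$ with $\omega(v,Jv)>0$ for every such $v$. Let $U\subseteq\mathbb C^m$ be an open neighbourhood of $0$. (1) Let $p:U\to\mathbb R$ be a strictly plurisubharmonic $C^\infty$ function with $p(0)=0$ and $\nabla p(0)=0$. Then there exist $\epsilon>0$, a strictly plurisubharmonic $C^\infty$ function $q:U\setminus\{0\}\to\mathbb R$, and open neighbourhoods $W,V$ of $0$ with $\overline W\subseteq V$ and with $\overline V$ a compact subset of $U$, such that $q=p$ on $U\setminus V$ and $q=\epsilon r_\lambda^2$ on $W\setminus\{0\}$. (2) Let $\omega$ be a Kähler form on $U$. Then there exist $\epsilon>0$, a Kähler form $\omega'$ on $U\setminus\{0\}$, and open neighbourhoods $W,V$ of $0$ with $\overline W\subseteq V$ and with $\overline V$ a compact subset of $U$, such that $\omega'=\omega$ on $U\setminus V$ and $\omega'=\epsilon\,dd^cr_\lambda^2$ on $W\setminus\{0\}$. -/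

import Mathlib

open scoped Topology ContDiff

namespace KahlerCone

/-- The complex vector space `ℂ^m` with its Euclidean norm `r`, where `r² = |z_1|² + ⋯ + |z_m|²`. -/
abbrev Cn (m : ℕ) : Type := EuclideanSpace ℂ (Fin m)

noncomputable section

variable {m : ℕ}

/-! ### The complex structure, `d^c`, strictly plurisubharmonic functions, Kähler forms -/

/-- The standard complex structure `J` of `ℂ^m` : multiplication by `i`, as a real-linear map. -/
def J (m : ℕ) : Cn m →L[ℝ] Cn m := Complex.I • ContinuousLinearMap.id ℝ (Cn m)

@[simp] theorem J_apply (v : Cn m) : J m v = Complex.I • v := rfl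

/-- The real `1`-form `d^c f = -(df) ∘ J = i (∂̄ - ∂) f`. -/
def dc (f : Cn m → ℝ) (z : Cn m) : Cn m [⋀^Fin 1]→L[ℝ] ℝ :=
  ContinuousAlternatingMap.ofSubsingleton ℝ (Cn m) ℝ (0 : Fin 1) (-((fderiv ℝ f z).comp (J m)))

/-- The real `2`-form `d d^c f = 2 i ∂ ∂̄ f`, with `d` the exterior derivative. -/
def ddc (f : Cn m → ℝ) : Cn m → Cn m [⋀^Fin 2]→L[ℝ] ℝ := extDeriv (dc f)

/-- `f` restricts to a strictly plurisubharmonic `C^∞` function on the open set `Y` :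
`d d^c f (v, J v) > 0` for every nonzero tangent vector `v` at every point of `Y`. -/
structure IsStrictlyPSHOn (f : Cn m → ℝ) (Y : Set (Cn m)) : Prop where
  smooth : ContDiffOn ℝ ∞ f Y
  pos : ∀ z ∈ Y, ∀ v : Cn m, v ≠ 0 → 0 < ddc f z ![v, J m v]

/-- `θ` restricts to a Kähler form on the open set `Y` : a `C^∞` closed real `(1,1)`-form
which is positive definite. -/
structure IsKahlerFormOn (θ : Cn m → Cn m [⋀^Fin 2]→L[ℝ] ℝ) (Y : Set (Cn m)) : Prop where
  smooth : ContDiffOn ℝ ∞ θ Y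
  closed : ∀ z ∈ Y, extDeriv θ z = 0
  invariant : ∀ z ∈ Y, ∀ v w : Cn m, θ z ![J m v, J m w] = θ z ![v, w]
  pos : ∀ z ∈ Y, ∀ v : Cn m, v ≠ 0 → 0 < θ z ![v, J m v]

/-! ### The radius function of the deformed cone -/

/-- The vector field `ξ' = i ∑ λ_a (z_a ∂/∂z_a - z̄_a ∂/∂z̄_a)`, whose value at `z` is the tangent
vector `(i λ_1 z_1, …, i λ_m z_m)`. Its restriction to the unit sphere is the Reeb vector field of
the deformed Sasakian structure. -/
def reeb (lam : Fin m → ℝ) (z : Cn m) : Cn m :=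
  WithLp.toLp 2 fun a => Complex.I * ((lam a : ℂ) * z a)

/-- The flow of `-J ξ'`, namely `(t, z) ↦ (e^{λ_1 t} z_1, …, e^{λ_m t} z_m)`. -/
def flow (lam : Fin m → ℝ) (t : ℝ) (z : Cn m) : Cn m :=
  WithLp.toLp 2 fun a => (Real.exp (lam a * t) : ℂ) * z a

@[simp] theorem flow_apply (lam : Fin m → ℝ) (t : ℝ) (z : Cn m) (a : Fin m) :
    flow lam t z a = (Real.exp (lam a * t) : ℂ) * z a := rfl

theorem flow_zero (lam : Fin m → ℝ) (z : Cn m) : flow lam 0 z = z := by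
  ext a; simp

theorem flow_add (lam : Fin m → ℝ) (s t : ℝ) (z : Cn m) :
    flow lam (s + t) z = flow lam s (flow lam t z) := by
  ext a
  simp only [flow_apply, mul_add, Real.exp_add, Complex.ofReal_mul, mul_assoc]

theorem flow_neg_flow (lam : Fin m → ℝ) (t : ℝ) (z : Cn m) : flow lam (-t) (flow lam t z) = z := by
  rw [← flow_add, neg_add_cancel, flow_zero]

theorem flow_flow_neg (lam : Fin m → ℝ) (t : ℝ) (z : Cn m) : flow lam t (flow lam (-t) z) = z := by
  rw [← flow_add, add_neg_cancel, flow_zero]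

/-- `flow lam` is the flow of the vector field `-J ξ'`. -/
theorem hasDerivAt_flow (lam : Fin m → ℝ) (z : Cn m) (t : ℝ) :
    HasDerivAt (fun s => flow lam s z) (-(J m (reeb lam (flow lam t z)))) t := by
  have h : ∀ a, HasDerivAt (fun s : ℝ => (Real.exp (lam a * s) : ℂ) * z a)
      (((Real.exp (lam a * t) * lam a : ℝ) : ℂ) * z a) t := fun a => by
    have h1 : HasDerivAt (fun s : ℝ => Real.exp (lam a * s)) (Real.exp (lam a * t) * lam a) t := by
      simpa using ((hasDerivAt_id t).const_mul (lam a)).exp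
    exact h1.ofReal_comp.mul_const (z a)
  have h2 := (PiLp.hasFDerivAt_toLp (𝕜 := ℝ) 2 (fun a => (Real.exp (lam a * t) : ℂ) * z a)
    ).comp_hasDerivAt t (hasDerivAt_pi.2 h)
  refine h2.congr_deriv ?_
  ext a
  simp only [J_apply, reeb, flow, PiLp.neg_apply, PiLp.smul_apply, smul_eq_mul,
    ContinuousLinearEquiv.coe_coe, PiLp.coe_symm_continuousLinearEquiv]
  rw [← mul_assoc Complex.I, Complex.I_mul_I]
  push_cast
  ring

/-- `F` is a bijection `ℂ^m ∖ {0} → (0,∞) × S^{2m-1}` which is the identity upon the unit sphere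
`{1} × S^{2m-1}`, and which is equivariant under the flow of `-J ξ'` on the domain and the flow
`(t; s, w) ↦ (e^t s, w)` of `r ∂/∂r` on the codomain. -/
structure IsConeMap (lam : Fin m → ℝ) (F : Cn m → ℝ × Cn m) : Prop where
  bijOn : Set.BijOn F {0}ᶜ (Set.Ioi 0 ×ˢ Metric.sphere 0 1)
  identity : ∀ w ∈ Metric.sphere (0 : Cn m) 1, F w = (1, w)
  equivariant : ∀ (t : ℝ) (z : Cn m), z ≠ 0 →
    F (flow lam t z) = (Real.exp t * (F z).1, (F z).2)

/-- The time `t` for which `z` is the image under the time-`t` flow of a point of the unit sphere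
(unique if all the `λ_a` are positive and `z ≠ 0`). -/
def coneTime (lam : Fin m → ℝ) (z : Cn m) : ℝ :=
  Classical.epsilon fun t : ℝ => flow lam (-t) z ∈ Metric.sphere (0 : Cn m) 1

/-- The map `F : ℂ^m ∖ {0} → (0,∞) × S^{2m-1}` (with a junk value at `0`). -/
def coneMap (lam : Fin m → ℝ) (z : Cn m) : ℝ × Cn m :=
  (Real.exp (coneTime lam z), flow lam (-coneTime lam z) z)

/-- The radius function `r_λ = F^* r : ℂ^m ∖ {0} → (0,∞)`. -/
def radius (lam : Fin m → ℝ) (z : Cn m) : ℝ := (coneMap lam z).1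

theorem normSq_flow (lam : Fin m → ℝ) (t : ℝ) (z : Cn m) :
    ‖flow lam t z‖ ^ 2 = ∑ a, Real.exp (lam a * t) ^ 2 * ‖z a‖ ^ 2 := by
  rw [EuclideanSpace.norm_sq_eq]
  refine Finset.sum_congr rfl fun a _ => ?_
  rw [flow_apply, norm_mul, Complex.norm_real, Real.norm_of_nonneg (Real.exp_pos _).le, mul_pow]

theorem exists_flow_mem_sphere {lam : Fin m → ℝ} (hlam : ∀ a, 0 < lam a) {z : Cn m} (hz : z ≠ 0) :
    ∃ t : ℝ, flow lam (-t) z ∈ Metric.sphere (0 : Cn m) 1 := by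
  have hc : Continuous fun t : ℝ => ‖flow lam t z‖ ^ 2 := by
    simp only [normSq_flow]; fun_prop
  obtain ⟨a, ha⟩ : ∃ a, z a ≠ 0 := by
    by_contra! h
    exact hz (by ext a; simpa using h a)
  have hbot : Filter.Tendsto (fun t : ℝ => ‖flow lam t z‖ ^ 2) Filter.atBot (𝓝 0) := by
    simp only [normSq_flow]
    have : (0 : ℝ) = ∑ b : Fin m, (0 : ℝ) ^ 2 * ‖z b‖ ^ 2 := by simp
    rw [this]
    refine tendsto_finsetSum _ fun b _ => Filter.Tendsto.mul_const _ (Filter.Tendsto.pow ?_ 2)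
    exact Real.tendsto_exp_atBot.comp (Filter.tendsto_id.const_mul_atBot (hlam b))
  have htop : Filter.Tendsto (fun t : ℝ => ‖flow lam t z‖ ^ 2) Filter.atTop Filter.atTop := by
    have h1 : Filter.Tendsto (fun t : ℝ => Real.exp (lam a * t) ^ 2 * ‖z a‖ ^ 2)
        Filter.atTop Filter.atTop := by
      refine Filter.Tendsto.atTop_mul_const (by positivity) ?_
      exact (Filter.tendsto_pow_atTop two_ne_zero).comp
        (Real.tendsto_exp_atTop.comp (Filter.tendsto_id.const_mul_atTop (hlam a)))
    refine Filter.tendsto_atTop_mono (fun t => ?_) h1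
    rw [normSq_flow]
    exact Finset.single_le_sum (f := fun a => Real.exp (lam a * t) ^ 2 * ‖z a‖ ^ 2)
      (fun b _ => by positivity) (Finset.mem_univ a)
  obtain ⟨s, hs⟩ := (hbot.eventually_lt_const (zero_lt_one)).exists
  obtain ⟨s', hs'⟩ := (htop.eventually_ge_atTop 1).exists
  obtain ⟨t, ht⟩ := mem_range_of_exists_le_of_exists_ge hc ⟨s, hs.le⟩ ⟨s', hs'⟩
  refine ⟨-t, ?_⟩
  rw [neg_neg, mem_sphere_zero_iff_norm]
  have h2 : ‖flow lam t z‖ ^ 2 = 1 := ht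
  nlinarith [norm_nonneg (flow lam t z)]

theorem norm_flow_lt {lam : Fin m → ℝ} (hlam : ∀ a, 0 < lam a) {z : Cn m} (hz : z ≠ 0)
    {s t : ℝ} (hst : s < t) : ‖flow lam s z‖ < ‖flow lam t z‖ := by
  obtain ⟨a, ha⟩ : ∃ a, z a ≠ 0 := by
    by_contra! h
    exact hz (by ext a; simpa using h a)
  have h : ‖flow lam s z‖ ^ 2 < ‖flow lam t z‖ ^ 2 := by
    rw [normSq_flow, normSq_flow]
    have key : ∀ b, Real.exp (lam b * s) ^ 2 < Real.exp (lam b * t) ^ 2 := fun b =>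
      pow_lt_pow_left₀ (Real.exp_lt_exp.2 (mul_lt_mul_of_pos_left hst (hlam b)))
        (Real.exp_pos _).le two_ne_zero
    refine Finset.sum_lt_sum (fun b _ => ?_) ⟨a, Finset.mem_univ a, ?_⟩
    · exact mul_le_mul_of_nonneg_right (key b).le (by positivity)
    · exact mul_lt_mul_of_pos_right (key a) (by positivity)
  exact lt_of_pow_lt_pow_left₀ 2 (norm_nonneg _) h

theorem flow_coneTime_mem {lam : Fin m → ℝ} (hlam : ∀ a, 0 < lam a) {z : Cn m} (hz : z ≠ 0) :
    flow lam (-coneTime lam z) z ∈ Metric.sphere (0 : Cn m) 1 :=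
  Classical.epsilon_spec (exists_flow_mem_sphere hlam hz)

theorem coneTime_eq {lam : Fin m → ℝ} (hlam : ∀ a, 0 < lam a) {z : Cn m} (hz : z ≠ 0) {t : ℝ}
    (ht : flow lam (-t) z ∈ Metric.sphere (0 : Cn m) 1) : coneTime lam z = t := by
  have h := flow_coneTime_mem hlam hz
  rw [mem_sphere_zero_iff_norm] at h ht
  rcases lt_trichotomy (coneTime lam z) t with hlt | heq | hgt
  · have := norm_flow_lt hlam hz (neg_lt_neg hlt)
    linarith
  · exact heq
  · have := norm_flow_lt hlam hz (neg_lt_neg hgt)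
    linarith

theorem flow_ne_zero (lam : Fin m → ℝ) (t : ℝ) {z : Cn m} (hz : z ≠ 0) : flow lam t z ≠ 0 := by
  intro h
  apply hz
  rw [← flow_neg_flow lam t z, h]
  ext a; simp

/-- The map `F` exists: `coneMap` has its defining properties. -/
theorem isConeMap_coneMap {lam : Fin m → ℝ} (hlam : ∀ a, 0 < lam a) :
    IsConeMap lam (coneMap lam) where
  bijOn := by
    refine ⟨fun z hz => ⟨Real.exp_pos _, flow_coneTime_mem hlam hz⟩, fun z _ z' _ h => ?_, ?_⟩
    · have h1 : coneTime lam z = coneTime lam z' := Real.exp_injective (congrArg Prod.fst h)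
      have h2 : flow lam (-coneTime lam z) z = flow lam (-coneTime lam z') z' :=
        congrArg Prod.snd h
      rw [← flow_flow_neg lam (coneTime lam z) z, h2, h1, flow_flow_neg]
    · rintro ⟨s, w⟩ ⟨hs, hw⟩
      have hw0 : w ≠ 0 := by
        rintro rfl
        simp at hw
      have e : flow lam (-Real.log s) (flow lam (Real.log s) w) = w := flow_neg_flow _ _ _
      have ht : coneTime lam (flow lam (Real.log s) w) = Real.log s :=
        coneTime_eq hlam (flow_ne_zero _ _ hw0) (by rw [e]; exact hw)
      refine ⟨flow lam (Real.log s) w, flow_ne_zero _ _ hw0, ?_⟩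
      rw [coneMap, ht, e, Real.exp_log hs]
  identity := by
    intro w hw
    have hw0 : w ≠ 0 := by
      rintro rfl
      simp at hw
    have ht : coneTime lam w = 0 := coneTime_eq hlam hw0 (by rw [neg_zero, flow_zero]; exact hw)
    rw [coneMap, ht, neg_zero, flow_zero, Real.exp_zero]
  equivariant := by
    intro t z hz
    have e : flow lam (-(t + coneTime lam z)) (flow lam t z) = flow lam (-coneTime lam z) z := by
      rw [← flow_add]; congr 1; ring
    have ht : coneTime lam (flow lam t z) = t + coneTime lam z :=
      coneTime_eq hlam (flow_ne_zero _ _ hz) (by rw [e]; exact flow_coneTime_mem hlam hz)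
    simp only [coneMap, ht, e, Real.exp_add]

/-- The map `F` is determined on `ℂ^m ∖ {0}` by its defining properties. -/
theorem IsConeMap.eq_coneMap {lam : Fin m → ℝ} (hlam : ∀ a, 0 < lam a) {F : Cn m → ℝ × Cn m}
    (hF : IsConeMap lam F) {z : Cn m} (hz : z ≠ 0) : F z = coneMap lam z := by
  have h := flow_coneTime_mem hlam hz
  have h1 := hF.equivariant (coneTime lam z) _ (flow_ne_zero lam (-coneTime lam z) hz)
  rw [flow_flow_neg, hF.identity _ h] at h1
  rw [h1, coneMap, mul_one]

end

end KahlerCone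

namespace KahlerCone

/-! Write `N = ‖z‖²` and let the Levi form of `f` at `v` be `D²f(v,v) + D²f(Jv,Jv)`, which is `dd^c
f(v, Jv)`.

The function `r_λ²` is strictly plurisubharmonic away from `0`. It equals `exp (2T)`, where `T`
solves `∑ exp(-2 λ_a T) |z_a|² = 1`. Applying the Levi form to this equation expresses a positive
multiple of the Levi form of `T` as a sum of squares (`levi_coneTime`), and the exponential adds a
positive multiple of `dT(v)² + dT(Jv)²`.

For (1), `p` and `r_λ²` have different orders of growth at `0`, so the gluing passes through `N`,
with `q = p + ψ(N) (A(N) - p) + M⁻¹ ψ₂(N) r_λ²`. Going inwards, the logarithmic cutoff `ψ` replaces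
`p` by `N - K`. Its derivatives have size `1/(L N)` and `1/(L N²)`, while `p = O(N)` and `dp =
O(‖z‖)`, so the error in the Levi form is `O(1/L)` (`levi_interpolation_pos`). The convex ramp `A`
then takes `N - K` down to `0` without spoiling plurisubharmonicity. The term `M⁻¹ r_λ²` is cut off
by `ψ₂` in a shell where `A(N) = N - K` has room to absorb the error; this fixes `ε = M⁻¹`.

For (2), a Kähler form has a potential near `0` (`exists_local_potential`). By the Poincaré lemma `ω
= dβ`. Since `ω` is of type (1,1), the (0,1)-part of `β` is `∂̄`-closed, hence equal to `∂̄f` near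
`0` by the Dolbeault-Grothendieck lemma, and `Im f` is the potential. Subtracting its affine part
reduces (2) to (1) on a small ball. The `∂̄`-lemma rests on the Cauchy-Pompeiu formula and on smooth
dependence of integrals on parameters. -/

theorem two_le_infty : (2 : WithTop ℕ∞) ≤ ∞ := by
  exact WithTop.coe_le_coe.2 (le_top : (2 : ℕ∞) ≤ ⊤)

/-! ### Second derivatives -/

section Hessian

variable {E : Type*} [NormedAddCommGroup E] [NormedSpace ℝ E]

/-- The second derivative of `f` at `z` in the direction `v`. -/
noncomputable def secondDeriv (f : E → ℝ) (z v : E) : ℝ := fderiv ℝ (fderiv ℝ f) z v v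

theorem differentiableAt_fderiv {F : Type*} [NormedAddCommGroup F] [NormedSpace ℝ F] {f : E → F}
    {z : E} (hf : ContDiffAt ℝ 2 f z) :
    DifferentiableAt ℝ (fderiv ℝ f) z :=
  (hf.fderiv_right (m := 1) (by norm_num)).differentiableAt one_ne_zero

theorem fderiv_fderiv_apply {F : Type*} [NormedAddCommGroup F] [NormedSpace ℝ F] {f : E → F}
    {z : E} (hf : ContDiffAt ℝ 2 f z) (v w : E) :
    fderiv ℝ (fun x => fderiv ℝ f x w) z v = fderiv ℝ (fderiv ℝ f) z v w := by
  rw [fderiv_clm_apply (differentiableAt_fderiv hf) (differentiableAt_const w)]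
  simp

theorem differentiableAt_fderiv_apply {f : E → ℝ} {z : E} (hf : ContDiffAt ℝ 2 f z) (w : E) :
    DifferentiableAt ℝ (fun x => fderiv ℝ f x w) z :=
  (differentiableAt_fderiv hf).clm_apply (differentiableAt_const w)

/-- Turns second derivatives into iterated derivatives of scalar functions, to which the product and
chain rules apply directly. -/
theorem secondDeriv_eq {f : E → ℝ} {z : E} (hf : ContDiffAt ℝ 2 f z) (v : E) :
    secondDeriv f z v = fderiv ℝ (fun x => fderiv ℝ f x v) z v :=
  (fderiv_fderiv_apply hf v v).symm

theorem ContDiffAt.eventually_differentiableAt {f : E → ℝ} {z : E} (hf : ContDiffAt ℝ 2 f z) :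
    ∀ᶠ x in 𝓝 z, DifferentiableAt ℝ f x :=
  (hf.eventually (by simp)).mono fun _ hx => hx.differentiableAt two_ne_zero

theorem secondDeriv_congr {f g : E → ℝ} {z : E} (h : f =ᶠ[𝓝 z] g) (v : E) :
    secondDeriv f z v = secondDeriv g z v := by
  rw [secondDeriv, secondDeriv, (h.fderiv).fderiv_eq]

theorem secondDeriv_add {f g : E → ℝ} {z : E} (hf : ContDiffAt ℝ 2 f z) (hg : ContDiffAt ℝ 2 g z)
    (v : E) :
    secondDeriv (fun x => f x + g x) z v = secondDeriv f z v + secondDeriv g z v := by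
  have h : fderiv ℝ (fun x => f x + g x) =ᶠ[𝓝 z] fun x => fderiv ℝ f x + fderiv ℝ g x := by
    filter_upwards [ContDiffAt.eventually_differentiableAt hf,
      ContDiffAt.eventually_differentiableAt hg] with x h1 h2
    exact fderiv_fun_add h1 h2
  rw [secondDeriv, h.fderiv_eq,
    fderiv_fun_add (differentiableAt_fderiv hf) (differentiableAt_fderiv hg)]
  rfl

theorem secondDeriv_const_mul {f : E → ℝ} {z : E} (hf : ContDiffAt ℝ 2 f z) (c : ℝ) (v : E) :
    secondDeriv (fun x => c * f x) z v = c * secondDeriv f z v := by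
  have h : fderiv ℝ (fun x => c * f x) =ᶠ[𝓝 z] fun x => c • fderiv ℝ f x := by
    filter_upwards [ContDiffAt.eventually_differentiableAt hf] with x h1
    exact fderiv_const_mul h1 c
  rw [secondDeriv, h.fderiv_eq, fderiv_fun_const_smul (differentiableAt_fderiv hf)]
  rfl

theorem secondDeriv_sub {f g : E → ℝ} {z : E} (hf : ContDiffAt ℝ 2 f z) (hg : ContDiffAt ℝ 2 g z)
    (v : E) :
    secondDeriv (fun x => f x - g x) z v = secondDeriv f z v - secondDeriv g z v := by
  have h : (fun x => f x - g x) = fun x => f x + (-1) * g x := by ext; ring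
  rw [h, secondDeriv_add hf (contDiffAt_const.mul hg), secondDeriv_const_mul hg]
  ring

theorem secondDeriv_mul {f g : E → ℝ} {z : E} (hf : ContDiffAt ℝ 2 f z) (hg : ContDiffAt ℝ 2 g z)
    (v : E) :
    secondDeriv (fun x => f x * g x) z v =
      f z * secondDeriv g z v + 2 * (fderiv ℝ f z v * fderiv ℝ g z v) +
        g z * secondDeriv f z v := by
  have h : (fun x => fderiv ℝ (fun x => f x * g x) x v) =ᶠ[𝓝 z]
      fun x => f x * fderiv ℝ g x v + g x * fderiv ℝ f x v := by
    filter_upwards [ContDiffAt.eventually_differentiableAt hf,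
      ContDiffAt.eventually_differentiableAt hg] with x h1 h2
    rw [fderiv_fun_mul h1 h2]
    simp
  have df := hf.differentiableAt two_ne_zero
  have dg := hg.differentiableAt two_ne_zero
  have df' := differentiableAt_fderiv_apply hf v
  have dg' := differentiableAt_fderiv_apply hg v
  rw [secondDeriv_eq (hf.mul hg), h.fderiv_eq, fderiv_fun_add (df.fun_mul dg') (dg.fun_mul df'),
    fderiv_fun_mul df dg', fderiv_fun_mul dg df', secondDeriv_eq hf, secondDeriv_eq hg]
  simp
  ring

theorem secondDeriv_comp {f : E → ℝ} {z : E} {φ : ℝ → ℝ} (hφ : ContDiffAt ℝ 2 φ (f z))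
    (hf : ContDiffAt ℝ 2 f z) (v : E) :
    secondDeriv (fun x => φ (f x)) z v =
      deriv (deriv φ) (f z) * fderiv ℝ f z v ^ 2 + deriv φ (f z) * secondDeriv f z v := by
  have h : (fun x => fderiv ℝ (fun x => φ (f x)) x v) =ᶠ[𝓝 z]
      fun x => deriv φ (f x) * fderiv ℝ f x v := by
    filter_upwards [ContDiffAt.eventually_differentiableAt hf,
      hf.continuousAt.eventually (ContDiffAt.eventually_differentiableAt hφ)] with x h1 h2
    have h3 : HasFDerivAt (fun x => φ (f x)) (deriv φ (f x) • fderiv ℝ f x) x :=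
      h2.hasDerivAt.comp_hasFDerivAt x h1.hasFDerivAt
    rw [h3.fderiv]
    simp
  have df := hf.differentiableAt two_ne_zero
  have df' := differentiableAt_fderiv_apply hf v
  have dφ : DifferentiableAt ℝ (deriv φ) (f z) := by
    have := differentiableAt_fderiv_apply hφ (1 : ℝ)
    simpa using this
  have dφf : HasFDerivAt (fun x => deriv φ (f x)) (deriv (deriv φ) (f z) • fderiv ℝ f z) z :=
    dφ.hasDerivAt.comp_hasFDerivAt z df.hasFDerivAt
  have hc : ContDiffAt ℝ 2 (fun x => φ (f x)) z := hφ.comp z hf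
  rw [secondDeriv_eq hc, h.fderiv_eq, fderiv_fun_mul dφf.differentiableAt df',
    dφf.fderiv, secondDeriv_eq hf]
  simp
  ring

end Hessian

/-! ### The Levi form -/

variable {m : ℕ}

/-- The Levi form `v ↦ dd^c f (v, J v)` of `f`, in terms of the second derivative of `f`. -/
noncomputable def levi (f : Cn m → ℝ) (z v : Cn m) : ℝ :=
  secondDeriv f z v + secondDeriv f z (J m v)

/-- Exhibits `dc f` as a fixed linear isometry applied to a 1-form, so that its smoothness follows
from that of `fderiv ℝ f`. -/
theorem dc_eq (f : Cn m → ℝ) : dc f = fun z =>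
    ContinuousAlternatingMap.ofSubsingletonLIE (𝕜 := ℝ) (E := Cn m) (F := ℝ) (0 : Fin 1)
      (-((fderiv ℝ f z).comp (J m))) := rfl

theorem contDiffAt_dc {f : Cn m → ℝ} {z : Cn m} {n k : WithTop ℕ∞} (hf : ContDiffAt ℝ n f z)
    (hk : k + 1 ≤ n) : ContDiffAt ℝ k (dc f) z := by
  rw [dc_eq]
  refine (ContinuousAlternatingMap.ofSubsingletonLIE (𝕜 := ℝ) (E := Cn m) (F := ℝ)
    (0 : Fin 1)).toContinuousLinearEquiv.contDiff.contDiffAt.comp z ?_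
  exact ((hf.fderiv_right hk).clm_comp contDiffAt_const).neg

theorem contDiffOn_ddc {f : Cn m → ℝ} {Y : Set (Cn m)} (hY : IsOpen Y) (hf : ContDiffOn ℝ ∞ f Y) :
    ContDiffOn ℝ ∞ (ddc f) Y := by
  have h1 : ContDiffOn ℝ ∞ (dc f) Y := fun z hz =>
    (contDiffAt_dc (hf.contDiffAt (hY.mem_nhds hz)) le_rfl).contDiffWithinAt
  exact (ContinuousAlternatingMap.alternatizeUncurryFinCLM ℝ (Cn m) ℝ).contDiff.comp_contDiffOn
    (h1.fderiv_of_isOpen (m := ∞) hY le_rfl)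

theorem extDeriv_ddc {f : Cn m → ℝ} {z : Cn m} (hf : ContDiffAt ℝ ∞ f z) :
    extDeriv (ddc f) z = 0 :=
  extDeriv_extDeriv_apply (contDiffAt_dc (k := ∞) hf le_rfl) (by simpa using two_le_infty)

theorem ddc_apply {f : Cn m → ℝ} {z : Cn m} (hf : ContDiffAt ℝ 2 f z) (v w : Cn m) :
    ddc f z ![v, w] =
      fderiv ℝ (fderiv ℝ f) z w (J m v) - fderiv ℝ (fderiv ℝ f) z v (J m w) := by
  have h1 : DifferentiableAt ℝ (dc f) z :=
    (contDiffAt_dc (k := 1) hf (by norm_num)).differentiableAt one_ne_zero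
  rw [ddc, extDeriv_apply h1, Fin.sum_univ_two]
  have e : ∀ u : Fin 1 → Cn m, (fun x => dc f x u) = fun x => -(fderiv ℝ f x (J m (u 0))) := by
    intro u; ext x; rfl
  rw [e, e, fderiv_fun_neg, fderiv_fun_neg]
  simp only [neg_apply, fderiv_fderiv_apply hf]
  simp [Fin.removeNth]
  ring

theorem J_J (v : Cn m) : J m (J m v) = -v := by
  simp [smul_smul]

theorem norm_J (v : Cn m) : ‖J m v‖ = ‖v‖ := by
  have h : ‖(Complex.I • v : Cn m)‖ = ‖v‖ := by
    rw [norm_smul, Complex.norm_I, one_mul]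
  exact h

theorem ddc_apply_J {f : Cn m → ℝ} {z : Cn m} (hf : ContDiffAt ℝ 2 f z) (v : Cn m) :
    ddc f z ![v, J m v] = levi f z v := by
  rw [ddc_apply hf, J_J, map_neg, levi, secondDeriv, secondDeriv]
  ring

/-- By `J² = -1` and the symmetry of the second derivative; this is the statement that `dd^c f` has
type (1,1). -/
theorem ddc_J_J {f : Cn m → ℝ} {z : Cn m} (hf : ContDiffAt ℝ 2 f z) (v w : Cn m) :
    ddc f z ![J m v, J m w] = ddc f z ![v, w] := by
  have hs := hf.isSymmSndFDerivAt (by simp)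
  rw [ddc_apply hf, ddc_apply hf, J_J, J_J, map_neg, map_neg, hs.eq (J m w) v, hs.eq (J m v) w]
  ring

theorem ddc_congr {f g : Cn m → ℝ} {z : Cn m} (h : f =ᶠ[𝓝 z] g) : ddc f z = ddc g z := by
  refine Filter.EventuallyEq.extDeriv_eq ?_
  filter_upwards [h.fderiv (𝕜 := ℝ)] with x hx
  rw [dc, dc, hx]

theorem ddc_const_mul {f : Cn m → ℝ} {z : Cn m} (hf : ContDiffAt ℝ 2 f z) (c : ℝ) :
    ddc (fun x => c * f x) z = c • ddc f z := by
  have h : dc (fun x => c * f x) =ᶠ[𝓝 z] c • dc f := by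
    filter_upwards [ContDiffAt.eventually_differentiableAt hf] with x h1
    rw [dc, fderiv_const_mul h1 c]
    ext u
    simp [dc]
  rw [ddc, h.extDeriv_eq, extDeriv_smul]
  rfl

theorem levi_congr {f g : Cn m → ℝ} {z : Cn m} (h : f =ᶠ[𝓝 z] g) (v : Cn m) :
    levi f z v = levi g z v := by
  rw [levi, levi, secondDeriv_congr h, secondDeriv_congr h]

theorem levi_add {f g : Cn m → ℝ} {z : Cn m} (hf : ContDiffAt ℝ 2 f z) (hg : ContDiffAt ℝ 2 g z)
    (v : Cn m) : levi (fun x => f x + g x) z v = levi f z v + levi g z v := by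
  simp only [levi, secondDeriv_add hf hg]; ring

theorem levi_sub {f g : Cn m → ℝ} {z : Cn m} (hf : ContDiffAt ℝ 2 f z) (hg : ContDiffAt ℝ 2 g z)
    (v : Cn m) : levi (fun x => f x - g x) z v = levi f z v - levi g z v := by
  simp only [levi, secondDeriv_sub hf hg]; ring

theorem levi_const_mul {f : Cn m → ℝ} {z : Cn m} (hf : ContDiffAt ℝ 2 f z) (c : ℝ) (v : Cn m) :
    levi (fun x => c * f x) z v = c * levi f z v := by
  simp only [levi, secondDeriv_const_mul hf]; ring

theorem levi_mul {f g : Cn m → ℝ} {z : Cn m} (hf : ContDiffAt ℝ 2 f z) (hg : ContDiffAt ℝ 2 g z)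
    (v : Cn m) :
    levi (fun x => f x * g x) z v = f z * levi g z v +
      2 * (fderiv ℝ f z v * fderiv ℝ g z v + fderiv ℝ f z (J m v) * fderiv ℝ g z (J m v)) +
        g z * levi f z v := by
  simp only [levi, secondDeriv_mul hf hg]; ring

/-- The source of every positivity by composition below: convex nondecreasing functions preserve
plurisubharmonicity. -/
theorem levi_comp {f : Cn m → ℝ} {z : Cn m} {φ : ℝ → ℝ} (hφ : ContDiffAt ℝ 2 φ (f z))
    (hf : ContDiffAt ℝ 2 f z) (v : Cn m) :
    levi (fun x => φ (f x)) z v =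
      deriv (deriv φ) (f z) * (fderiv ℝ f z v ^ 2 + fderiv ℝ f z (J m v) ^ 2) +
        deriv φ (f z) * levi f z v := by
  simp only [levi, secondDeriv_comp hφ hf]; ring

theorem fderiv_normSq (z v : Cn m) :
    fderiv ℝ (fun x : Cn m => ‖x‖ ^ 2) z v = 2 * inner ℝ z v := by
  rw [fderiv_norm_sq]
  simp

theorem contDiff_normSq {n : WithTop ℕ∞} : ContDiff ℝ n (fun x : Cn m => ‖x‖ ^ 2) :=
  contDiff_norm_sq ℝ

theorem abs_fderiv_normSq_le (z v : Cn m) :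
    |fderiv ℝ (fun x : Cn m => ‖x‖ ^ 2) z v| ≤ 2 * ‖z‖ * ‖v‖ := by
  rw [fderiv_normSq, abs_mul, abs_two, mul_assoc]
  exact mul_le_mul_of_nonneg_left (abs_real_inner_le_norm z v) zero_le_two

theorem secondDeriv_normSq (z v : Cn m) :
    secondDeriv (fun x : Cn m => ‖x‖ ^ 2) z v = 2 * ‖v‖ ^ 2 := by
  rw [secondDeriv_eq contDiff_normSq.contDiffAt]
  simp only [fderiv_normSq]
  have h : HasFDerivAt (fun x : Cn m => 2 * inner ℝ x v) ((2 : ℝ) • (innerSL ℝ v)) z := by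
    have := ((innerSL ℝ v).hasFDerivAt (x := z)).const_mul 2
    simpa [real_inner_comm] using this
  rw [h.fderiv]
  simp

theorem levi_normSq (z v : Cn m) : levi (fun x : Cn m => ‖x‖ ^ 2) z v = 4 * ‖v‖ ^ 2 := by
  rw [levi, secondDeriv_normSq, secondDeriv_normSq, norm_J]
  ring

theorem isStrictlyPSHOn_of_levi {f : Cn m → ℝ} {Y : Set (Cn m)} (hY : IsOpen Y)
    (hf : ContDiffOn ℝ ∞ f Y) (h : ∀ z ∈ Y, ∀ v, v ≠ 0 → 0 < levi f z v) :
    IsStrictlyPSHOn f Y where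
  smooth := hf
  pos z hz v hv := by
    rw [ddc_apply_J ((hf.contDiffAt (hY.mem_nhds hz)).of_le two_le_infty)]
    exact h z hz v hv

theorem IsStrictlyPSHOn.isKahlerFormOn {f : Cn m → ℝ} {Y : Set (Cn m)} (hY : IsOpen Y)
    (hf : IsStrictlyPSHOn f Y) : IsKahlerFormOn (ddc f) Y where
  smooth := contDiffOn_ddc hY hf.smooth
  closed _ hz := extDeriv_ddc (hf.smooth.contDiffAt (hY.mem_nhds hz))
  invariant _ hz v w := ddc_J_J ((hf.smooth.contDiffAt (hY.mem_nhds hz)).of_le two_le_infty) v w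
  pos := hf.pos

end KahlerCone

namespace KahlerCone

variable {m : ℕ}

/-! ### The radius function of the deformed cone is smooth and strictly plurisubharmonic -/

/-- The squared norm of the image of `p.1` under the flow at time `-p.2`. -/
noncomputable def flowNormSq (lam : Fin m → ℝ) (p : Cn m × ℝ) : ℝ :=
  ∑ a, Real.exp (-2 * lam a * p.2) * ‖p.1 a‖ ^ 2

theorem flowNormSq_eq (lam : Fin m → ℝ) (z : Cn m) (t : ℝ) :
    flowNormSq lam (z, t) = ‖flow lam (-t) z‖ ^ 2 := by
  rw [normSq_flow, flowNormSq]
  refine Finset.sum_congr rfl fun a _ => ?_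
  rw [← Real.exp_nat_mul]
  congr 2
  push_cast
  ring

theorem contDiff_coord {n : WithTop ℕ∞} (a : Fin m) : ContDiff ℝ n fun x : Cn m => x a :=
  ((EuclideanSpace.proj (𝕜 := ℂ) a).restrictScalars ℝ).contDiff

theorem contDiff_coord_normSq {n : WithTop ℕ∞} (a : Fin m) :
    ContDiff ℝ n fun x : Cn m => ‖x a‖ ^ 2 :=
  (contDiff_coord a).norm_sq ℝ

theorem contDiff_flowNormSq (lam : Fin m → ℝ) {n : WithTop ℕ∞} :
    ContDiff ℝ n (flowNormSq lam) := by
  refine ContDiff.sum fun a _ => ?_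
  exact (contDiff_const.mul contDiff_snd).exp.mul ((contDiff_coord_normSq a).comp contDiff_fst)

theorem flowNormSq_coneTime {lam : Fin m → ℝ} (hlam : ∀ a, 0 < lam a) {z : Cn m} (hz : z ≠ 0) :
    flowNormSq lam (z, coneTime lam z) = 1 := by
  have h := flow_coneTime_mem hlam hz
  rw [mem_sphere_zero_iff_norm] at h
  rw [flowNormSq_eq, h, one_pow]

theorem coneTime_eq_of_flowNormSq {lam : Fin m → ℝ} (hlam : ∀ a, 0 < lam a) {z : Cn m}
    (hz : z ≠ 0) {t : ℝ} (h : flowNormSq lam (z, t) = 1) : coneTime lam z = t := by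
  refine coneTime_eq hlam hz ?_
  rw [flowNormSq_eq] at h
  rw [mem_sphere_zero_iff_norm]
  nlinarith [norm_nonneg (flow lam (-t) z)]

/-- This sum is `-1/2` times the time derivative of `flowNormSq`. Its nonvanishing makes `coneTime`
smooth, and its sign makes `coneTime` plurisubharmonic. -/
theorem sum_flow_weights_pos {lam : Fin m → ℝ} (hlam : ∀ a, 0 < lam a) {z : Cn m} (hz : z ≠ 0)
    (t : ℝ) : 0 < ∑ a, lam a * (Real.exp (-2 * lam a * t) * ‖z a‖ ^ 2) := by
  obtain ⟨a, ha⟩ : ∃ a, z a ≠ 0 := by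
    by_contra! h
    exact hz (by ext a; simpa using h a)
  refine Finset.sum_pos' (fun b _ => ?_) ⟨a, Finset.mem_univ a, ?_⟩
  · have := hlam b; positivity
  · have := hlam a
    have := norm_pos_iff.2 ha
    positivity

theorem fderiv_flowNormSq_time (lam : Fin m → ℝ) (z : Cn m) (t : ℝ) :
    fderiv ℝ (flowNormSq lam) (z, t) (0, 1) =
      -2 * ∑ a, lam a * (Real.exp (-2 * lam a * t) * ‖z a‖ ^ 2) := by
  have h1 : HasDerivAt (fun s : ℝ => flowNormSq lam (z, s))
      (fderiv ℝ (flowNormSq lam) (z, t) (0, 1)) t := by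
    have hF : HasFDerivAt (flowNormSq lam) (fderiv ℝ (flowNormSq lam) (z, t)) (z, t) :=
      ((contDiff_flowNormSq lam (n := 1)).differentiable one_ne_zero _).hasFDerivAt
    exact hF.comp_hasDerivAt t ((hasDerivAt_const t z).prodMk (hasDerivAt_id t))
  have h2 : HasDerivAt (fun s : ℝ => flowNormSq lam (z, s))
      (∑ a, Real.exp (-2 * lam a * t) * (-2 * lam a) * ‖z a‖ ^ 2) t := by
    refine HasDerivAt.fun_sum fun a _ => ?_
    have h3 : HasDerivAt (fun s : ℝ => Real.exp (-2 * lam a * s))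
        (Real.exp (-2 * lam a * t) * (-2 * lam a)) t := by
      simpa using ((hasDerivAt_id t).const_mul (-2 * lam a)).exp
    exact h3.mul_const (‖z a‖ ^ 2)
  rw [h1.unique h2, Finset.mul_sum]
  exact Finset.sum_congr rfl fun a _ => by ring

/-- Implicit function theorem for `flowNormSq = 1`, solved for the time variable. -/
theorem contDiffAt_coneTime {lam : Fin m → ℝ} (hlam : ∀ a, 0 < lam a) {z : Cn m} (hz : z ≠ 0) :
    ContDiffAt ℝ ∞ (coneTime lam) z := by
  have cdf : ContDiffAt ℝ ∞ (flowNormSq lam) (z, coneTime lam z) :=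
    (contDiff_flowNormSq lam).contDiffAt
  have hinv : (fderiv ℝ (flowNormSq lam) (z, coneTime lam z) ∘L
      .inr ℝ (Cn m) ℝ).IsInvertible := by
    set D := fderiv ℝ (flowNormSq lam) (z, coneTime lam z) (0, 1) with hD
    have hD0 : D ≠ 0 := by
      rw [hD, fderiv_flowNormSq_time]
      have := sum_flow_weights_pos hlam hz (coneTime lam z)
      exact mul_ne_zero (by norm_num) this.ne'
    refine ⟨ContinuousLinearEquiv.unitsEquivAut ℝ (Units.mk0 D hD0), ?_⟩
    ext
    simp [hD]
  have pn : (∞ : WithTop ℕ∞) ≠ 0 := by simp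
  -- The flow time to the sphere is unique, so any local solution of the equation agrees with the
  -- globally chosen `coneTime`.
  refine (cdf.contDiffAt_implicitFunction pn hinv).congr_of_eventuallyEq ?_
  filter_upwards [cdf.eventually_apply_implicitFunction pn hinv, isOpen_ne.mem_nhds hz]
    with x hx hx0
  refine coneTime_eq_of_flowNormSq hlam hx0 ?_
  rw [hx, flowNormSq_coneTime hlam hz]

theorem levi_sum {ι : Type*} (s : Finset ι) {f : ι → Cn m → ℝ} {z : Cn m}
    (hf : ∀ i, ContDiffAt ℝ 2 (f i) z) (v : Cn m) :
    levi (fun x => ∑ i ∈ s, f i x) z v = ∑ i ∈ s, levi (f i) z v := by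
  classical
  induction s using Finset.induction_on with
  | empty => simp [levi, secondDeriv]
  | insert i s hi ih =>
    simp only [Finset.sum_insert hi]
    rw [levi_add (hf i) (ContDiffAt.sum fun j _ => hf j), ih]

theorem hasFDerivAt_coord (a : Fin m) (z : Cn m) :
    HasFDerivAt (fun x : Cn m => x a) ((EuclideanSpace.proj (𝕜 := ℂ) a).restrictScalars ℝ) z :=
  ((EuclideanSpace.proj (𝕜 := ℂ) a).restrictScalars ℝ).hasFDerivAt

theorem fderiv_coord_normSq (a : Fin m) (z v : Cn m) :
    fderiv ℝ (fun x : Cn m => ‖x a‖ ^ 2) z v = 2 * inner ℝ (z a) (v a) := by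
  rw [(hasFDerivAt_coord a z).norm_sq.fderiv]
  simp
  ring

theorem secondDeriv_coord_normSq (a : Fin m) (z v : Cn m) :
    secondDeriv (fun x : Cn m => ‖x a‖ ^ 2) z v = 2 * ‖v a‖ ^ 2 := by
  rw [secondDeriv_eq (contDiff_coord_normSq a).contDiffAt]
  simp only [fderiv_coord_normSq]
  have h : HasFDerivAt (fun x : Cn m => 2 * inner ℝ (v a) (x a)) ((2 : ℝ) • ((innerSL ℝ (v a)).comp
      ((EuclideanSpace.proj (𝕜 := ℂ) a).restrictScalars ℝ))) z :=
    (((innerSL ℝ (v a)).hasFDerivAt (x := z a)).comp z (hasFDerivAt_coord a z)).const_mul 2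
  simp only [real_inner_comm (v a)] at h ⊢
  rw [h.fderiv]
  simp [Complex.sq_norm, Complex.normSq_apply]

/-- The second-order consequence of the implicit equation for `coneTime`. -/
theorem levi_coneTime {lam : Fin m → ℝ} (hlam : ∀ a, 0 < lam a) {z : Cn m} (hz : z ≠ 0)
    (v : Cn m) :
    (∑ a, lam a * (Real.exp (-2 * lam a * coneTime lam z) * ‖z a‖ ^ 2)) *
        levi (coneTime lam) z v =
      2 * ∑ a, Real.exp (-2 * lam a * coneTime lam z) *
        ‖v a - lam a * (fderiv ℝ (coneTime lam) z v - fderiv ℝ (coneTime lam) z (J m v) *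
          Complex.I) * z a‖ ^ 2 := by
  have hT : ContDiffAt ℝ 2 (coneTime lam) z := (contDiffAt_coneTime hlam hz).of_le two_le_infty
  have hφ : ∀ a, ContDiffAt ℝ 2 (fun t : ℝ => Real.exp (-2 * lam a * t)) (coneTime lam z) :=
    fun a => (contDiff_const.mul contDiff_id).exp.contDiffAt
  have hg : ∀ a, ContDiffAt ℝ 2 (fun x => Real.exp (-2 * lam a * coneTime lam x)) z :=
    fun a => (hφ a).comp z hT
  have hn : ∀ a, ContDiffAt ℝ 2 (fun x : Cn m => ‖x a‖ ^ 2) z :=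
    fun a => (contDiff_coord_normSq a).contDiffAt
  have hd : ∀ a, deriv (fun t : ℝ => Real.exp (-2 * lam a * t)) =
      fun t => (-2 * lam a) * Real.exp (-2 * lam a * t) := by
    intro a
    ext t
    have := ((hasDerivAt_id t).const_mul (-2 * lam a)).exp.deriv
    simp only [id, mul_one] at this
    rw [this, mul_comm]
  -- The function is constantly `1` near `z`. Expanding this zero term by term gives the identity.
  have h0 : levi (fun x => ∑ a, Real.exp (-2 * lam a * coneTime lam x) * ‖x a‖ ^ 2) z v = 0 := by
    have : (fun x : Cn m => ∑ a, Real.exp (-2 * lam a * coneTime lam x) * ‖x a‖ ^ 2) =ᶠ[𝓝 z]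
        fun _ => 1 := by
      filter_upwards [isOpen_ne.mem_nhds hz] with x hx
      exact flowNormSq_coneTime hlam hx
    rw [levi_congr this]
    simp [levi, secondDeriv]
  rw [levi_sum _ fun a => (hg a).mul (hn a)] at h0
  set T := coneTime lam z
  set s₁ := fderiv ℝ (coneTime lam) z v
  set s₂ := fderiv ℝ (coneTime lam) z (J m v)
  -- The terms in `‖v a‖²`, the cross terms and the terms quadratic in `s₁, s₂` complete a square;
  -- only the term linear in the Levi form of `coneTime` is left over.
  have key : ∀ a, levi (fun x => Real.exp (-2 * lam a * coneTime lam x) * ‖x a‖ ^ 2) z v =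
      4 * (Real.exp (-2 * lam a * T) * ‖v a - lam a * (s₁ - s₂ * Complex.I) * z a‖ ^ 2) -
        2 * (lam a * (Real.exp (-2 * lam a * T) * ‖z a‖ ^ 2)) * levi (coneTime lam) z v := by
    intro a
    have hd' : ∀ w, fderiv ℝ (fun x => Real.exp (-2 * lam a * coneTime lam x)) z w =
        (-2 * lam a) * Real.exp (-2 * lam a * T) * fderiv ℝ (coneTime lam) z w := by
      intro w
      have h3 : HasFDerivAt (fun x => Real.exp (-2 * lam a * coneTime lam x))
          (deriv (fun t : ℝ => Real.exp (-2 * lam a * t)) T • fderiv ℝ (coneTime lam) z) z :=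
        HasDerivAt.comp_hasFDerivAt (f := coneTime lam) z
          ((hφ a).differentiableAt two_ne_zero).hasDerivAt (hT.differentiableAt two_ne_zero).hasFDerivAt
      rw [h3.fderiv, hd]
      simp
    rw [levi_mul (hg a) (hn a), levi_comp (hφ a) hT, hd', hd', hd, deriv_const_mul _
      ((hφ a).differentiableAt two_ne_zero), hd, fderiv_coord_normSq, fderiv_coord_normSq,
      levi, secondDeriv_coord_normSq, secondDeriv_coord_normSq]
    have hI : (J m v) a = Complex.I * v a := rfl
    rw [hI]
    simp only [Complex.inner, Complex.sq_norm, Complex.normSq_apply, Complex.mul_re,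
      Complex.mul_im, Complex.sub_re, Complex.sub_im, Complex.ofReal_re, Complex.ofReal_im,
      Complex.I_re, Complex.I_im, Complex.conj_re, Complex.conj_im]
    ring
  rw [Finset.sum_congr rfl fun a _ => key a, Finset.sum_sub_distrib, ← Finset.mul_sum,
    ← Finset.sum_mul, ← Finset.mul_sum] at h0
  linarith

theorem radius_sq_eq (lam : Fin m → ℝ) (z : Cn m) :
    radius lam z ^ 2 = Real.exp (2 * coneTime lam z) := by
  rw [radius, coneMap, ← Real.exp_nat_mul]
  norm_num

theorem contDiffOn_radius_sq {lam : Fin m → ℝ} (hlam : ∀ a, 0 < lam a) :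
    ContDiffOn ℝ ∞ (fun z => radius lam z ^ 2) {0}ᶜ := fun z hz => by
  simp only [radius_sq_eq]
  exact (contDiffAt_const.mul (contDiffAt_coneTime hlam hz)).exp.contDiffWithinAt

/-- The Levi form is `exp(2T) (4 (s₁² + s₂²) + 2 levi T)` with both parts nonnegative. If `s₁ = s₂ =
0`, the squares in `levi_coneTime` reduce to `‖v a‖²`, so the second part is positive. -/
theorem levi_radius_sq_pos {lam : Fin m → ℝ} (hlam : ∀ a, 0 < lam a) {z : Cn m} (hz : z ≠ 0)
    {v : Cn m} (hv : v ≠ 0) : 0 < levi (fun x => radius lam x ^ 2) z v := by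
  have hT : ContDiffAt ℝ 2 (coneTime lam) z := (contDiffAt_coneTime hlam hz).of_le two_le_infty
  have hφ : ContDiff ℝ 2 (fun t : ℝ => Real.exp (2 * t)) := (contDiff_const.mul contDiff_id).exp
  have hd : deriv (fun t : ℝ => Real.exp (2 * t)) = fun t => 2 * Real.exp (2 * t) := by
    ext t
    have := ((hasDerivAt_id t).const_mul 2).exp.deriv
    simp only [id, mul_one] at this
    rw [this, mul_comm]
  simp only [radius_sq_eq]
  rw [levi_comp (φ := fun t => Real.exp (2 * t)) hφ.contDiffAt hT, hd,
    deriv_const_mul _ (hφ.differentiable two_ne_zero _), hd]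
  have key := levi_coneTime hlam hz v
  have hD := sum_flow_weights_pos hlam hz (coneTime lam z)
  set D := ∑ a, lam a * (Real.exp (-2 * lam a * coneTime lam z) * ‖z a‖ ^ 2)
  set s₁ := fderiv ℝ (coneTime lam) z v
  set s₂ := fderiv ℝ (coneTime lam) z (J m v)
  have hS : 0 ≤ ∑ a, Real.exp (-2 * lam a * coneTime lam z) *
      ‖v a - lam a * (s₁ - s₂ * Complex.I) * z a‖ ^ 2 :=
    Finset.sum_nonneg fun a _ => by positivity
  have hL : 0 ≤ levi (coneTime lam) z v := by
    by_contra! h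
    nlinarith [mul_neg_of_pos_of_neg hD h]
  have hexp := Real.exp_pos (2 * coneTime lam z)
  by_cases hs : s₁ = 0 ∧ s₂ = 0
  · obtain ⟨a, ha⟩ : ∃ a, v a ≠ 0 := by
      by_contra! h
      exact hv (by ext a; simpa using h a)
    have hS' : 0 < ∑ a, Real.exp (-2 * lam a * coneTime lam z) *
        ‖v a - lam a * (s₁ - s₂ * Complex.I) * z a‖ ^ 2 := by
      refine Finset.sum_pos' (fun a _ => by positivity) ⟨a, Finset.mem_univ a, ?_⟩
      rw [hs.1, hs.2]
      have := norm_pos_iff.2 ha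
      simp only [Complex.ofReal_zero, zero_mul, sub_zero, mul_zero]
      positivity
    have hL' : 0 < levi (coneTime lam) z v := by
      by_contra! h
      nlinarith [mul_nonpos_of_nonneg_of_nonpos hD.le h]
    positivity
  · have : 0 < s₁ ^ 2 + s₂ ^ 2 := by
      by_contra! h
      exact hs ⟨by nlinarith [sq_nonneg s₁, sq_nonneg s₂], by nlinarith [sq_nonneg s₁, sq_nonneg s₂]⟩
    positivity

end KahlerCone

namespace KahlerCone

/-! ### Cutoff functions of a real variable -/

/-- Both derivatives are continuous and supported in `[0,1]`. -/
theorem exists_smoothTransition_deriv_bound :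
    ∃ B : ℝ, 0 < B ∧ ∀ x, |deriv Real.smoothTransition x| ≤ B ∧
      |deriv (deriv Real.smoothTransition) x| ≤ B := by
  have hσ : ContDiff ℝ ∞ Real.smoothTransition := Real.smoothTransition.contDiff
  have h1 : ContDiff ℝ ∞ (deriv Real.smoothTransition) := (contDiff_infty_iff_deriv.1 hσ).2
  have h2 : ContDiff ℝ ∞ (deriv (deriv Real.smoothTransition)) :=
    (contDiff_infty_iff_deriv.1 h1).2
  have hs : HasCompactSupport (deriv Real.smoothTransition) := by
    refine HasCompactSupport.intro (isCompact_Icc (a := (0 : ℝ)) (b := 1)) fun x hx => ?_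
    rw [Set.mem_Icc, not_and_or, not_le, not_le] at hx
    rcases hx with hx | hx
    · have : Real.smoothTransition =ᶠ[𝓝 x] fun _ => 0 := by
        filter_upwards [Iio_mem_nhds hx] with y hy
        exact Real.smoothTransition.zero_of_nonpos (le_of_lt hy)
      rw [this.deriv_eq]; simp
    · have : Real.smoothTransition =ᶠ[𝓝 x] fun _ => 1 := by
        filter_upwards [Ioi_mem_nhds hx] with y hy
        exact Real.smoothTransition.one_of_one_le (le_of_lt hy)
      rw [this.deriv_eq]; simp
  obtain ⟨B₁, hB₁⟩ := hs.exists_bound_of_continuous h1.continuous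
  obtain ⟨B₂, hB₂⟩ := hs.deriv.exists_bound_of_continuous h2.continuous
  refine ⟨max (max B₁ B₂) 1, by positivity, fun x => ⟨?_, ?_⟩⟩
  · exact (hB₁ x).trans ((le_max_left _ _).trans (le_max_left _ _))
  · exact (hB₂ x).trans ((le_max_right _ _).trans (le_max_left _ _))

/-- Logarithmic cutoff functions: equal to `1` up to `b` and to `0` from `b e^L` on, with
logarithmic derivatives of size `1 / L`. -/
theorem exists_log_cutoff :
    ∃ B : ℝ, 0 < B ∧ ∀ b L : ℝ, 0 < b → 1 ≤ L → ∃ ψ : ℝ → ℝ,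
      (∀ t, 0 < t → ContDiffAt ℝ ∞ ψ t) ∧ (∀ t, 0 ≤ ψ t ∧ ψ t ≤ 1) ∧
      (∀ t, 0 < t → t ≤ b → ψ t = 1) ∧ (∀ t, b * Real.exp L ≤ t → ψ t = 0) ∧
      (∀ t, 0 < t → |deriv ψ t| ≤ B / L / t) ∧
      (∀ t, 0 < t → |deriv (deriv ψ) t| ≤ 2 * (B / L) / t ^ 2) := by
  obtain ⟨B, hB, hbd⟩ := exists_smoothTransition_deriv_bound
  refine ⟨B, hB, fun b L hb hL => ?_⟩
  have hL0 : 0 < L := by linarith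
  have hσ : ContDiff ℝ ∞ Real.smoothTransition := Real.smoothTransition.contDiff
  have hσ' : ContDiff ℝ ∞ (deriv Real.smoothTransition) := (contDiff_infty_iff_deriv.1 hσ).2
  -- The logarithmic scale maps `[b, b e^L]` onto `[0,1]` and has derivative `1 / (L t)`: a long
  -- window makes the scale-invariant derivatives small.
  set u : ℝ → ℝ := fun t => (Real.log t - Real.log b) / L with hu
  have hud : ∀ t, 0 < t → HasDerivAt u (t⁻¹ / L) t := fun t ht =>
    ((Real.hasDerivAt_log ht.ne').sub_const _).div_const L
  have h1 : ∀ t, 0 < t → HasDerivAt (fun t => 1 - Real.smoothTransition (u t))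
      (-(deriv Real.smoothTransition (u t) * (t⁻¹ / L))) t := fun t ht =>
    (((hσ.differentiable (by simp) _).hasDerivAt).comp t (hud t ht)).const_sub 1
  have h2 : ∀ t, 0 < t → HasDerivAt (deriv fun t => 1 - Real.smoothTransition (u t))
      (-(deriv (deriv Real.smoothTransition) (u t) * (t⁻¹ / L) * (t⁻¹ / L) +
        deriv Real.smoothTransition (u t) * (-(t ^ 2)⁻¹ / L))) t := by
    intro t ht
    have h3 : HasDerivAt (fun t => -(deriv Real.smoothTransition (u t) * (t⁻¹ / L))) _ t :=
      (((((hσ'.differentiable (by simp) _).hasDerivAt).comp t (hud t ht))).mul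
        ((hasDerivAt_inv ht.ne').div_const L)).neg
    refine h3.congr_of_eventuallyEq ?_
    filter_upwards [Ioi_mem_nhds ht] with s hs
    exact (h1 s hs).deriv
  refine ⟨fun t => 1 - Real.smoothTransition (u t), fun t ht => ?_, fun t => ⟨?_, ?_⟩,
    fun t ht htb => ?_, fun t ht => ?_, fun t ht => ?_, fun t ht => ?_⟩
  · exact contDiffAt_const.sub (hσ.contDiffAt.comp t
      (((Real.contDiffAt_log.2 ht.ne').sub contDiffAt_const).div_const L))
  · linarith [Real.smoothTransition.le_one (u t)]
  · linarith [Real.smoothTransition.nonneg (u t)]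
  · have : u t ≤ 0 := div_nonpos_of_nonpos_of_nonneg
      (sub_nonpos.2 (Real.log_le_log ht htb)) hL0.le
    simp [Real.smoothTransition.zero_of_nonpos this]
  · have : 1 ≤ u t := by
      have h4 := Real.log_le_log (by positivity) ht
      rw [Real.log_mul hb.ne' (Real.exp_pos L).ne', Real.log_exp] at h4
      rw [hu, le_div_iff₀ hL0]
      linarith
    simp [Real.smoothTransition.one_of_one_le this]
  · rw [(h1 t ht).deriv, abs_neg, abs_mul, abs_of_pos (by positivity : 0 < t⁻¹ / L)]
    calc _ ≤ B * (t⁻¹ / L) := by gcongr; exact (hbd _).1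
      _ = B / L / t := by field_simp
  · rw [(h2 t ht).deriv, abs_neg]
    have e1 : |deriv (deriv Real.smoothTransition) (u t) * (t⁻¹ / L) * (t⁻¹ / L)| ≤
        B / L / t ^ 2 := by
      rw [abs_mul, abs_mul, abs_of_pos (by positivity : 0 < t⁻¹ / L)]
      calc _ ≤ B * (t⁻¹ / L) * (t⁻¹ / L) := by gcongr; exact (hbd _).2
        _ = B / L / t ^ 2 / L := by field_simp
        -- This term carries `1/L²`; `1 ≤ L` weakens it to match the bound on the other term.
        _ ≤ B / L / t ^ 2 := div_le_self (by positivity) hL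
    have e2 : |deriv Real.smoothTransition (u t) * (-(t ^ 2)⁻¹ / L)| ≤ B / L / t ^ 2 := by
      rw [abs_mul, neg_div, abs_neg, abs_of_pos (by positivity : 0 < (t ^ 2)⁻¹ / L)]
      calc _ ≤ B * ((t ^ 2)⁻¹ / L) := by gcongr; exact (hbd _).1
        _ = B / L / t ^ 2 := by field_simp
    calc _ ≤ B / L / t ^ 2 + B / L / t ^ 2 := (abs_add_le _ _).trans (add_le_add e1 e2)
      _ = _ := by ring

/-- A smooth nondecreasing convex function which vanishes up to `a` and has slope `1` from
`2 * a` on. -/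
theorem exists_convex_ramp {a : ℝ} (ha : 0 < a) :
    ∃ (A : ℝ → ℝ) (K : ℝ), ContDiff ℝ ∞ A ∧ |K| ≤ 2 * a ∧ (∀ t ≤ a, A t = 0) ∧
      (∀ t, 2 * a ≤ t → A t = t - K) ∧ (∀ t, 2 * a ≤ t → deriv A t = 1) ∧
      (∀ t, 0 ≤ deriv A t) ∧ (∀ t, 0 ≤ deriv (deriv A) t) := by
  set σ : ℝ → ℝ := fun s => Real.smoothTransition ((s - a) / a) with hσdef
  have hσ : ContDiff ℝ ∞ σ := Real.smoothTransition.contDiff.comp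
    ((contDiff_id.sub contDiff_const).div_const a)
  have hσ0 : ∀ t ≤ a, σ t = 0 := fun t ht => Real.smoothTransition.zero_of_nonpos
    (div_nonpos_of_nonpos_of_nonneg (by linarith) ha.le)
  have hσ1 : ∀ t, 2 * a ≤ t → σ t = 1 := fun t ht => Real.smoothTransition.one_of_one_le
    ((le_div_iff₀ ha).2 (by linarith))
  have hmono : Monotone σ := fun s t hst => Real.smoothTransition.monotone
    (div_le_div_of_nonneg_right (by linarith) ha.le)
  have hint : ∀ s t, IntervalIntegrable σ MeasureTheory.volume s t :=
    fun s t => hσ.continuous.intervalIntegrable s t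
  -- The primitive of a monotone step rising from `0` at `a` to `1` at `2a`: convexity is the
  -- monotonicity of `σ`, and `K = 2a - A(2a)` because the slope is `1` from there on.
  set A : ℝ → ℝ := fun t => ∫ s in (0 : ℝ)..t, σ s with hA
  have hd : ∀ t, HasDerivAt A (σ t) t := fun t =>
    intervalIntegral.integral_hasDerivAt_right (hint 0 t)
      (hσ.continuous.stronglyMeasurableAtFilter _ _) hσ.continuous.continuousAt
  have hd' : deriv A = σ := funext fun t => (hd t).deriv
  refine ⟨A, 2 * a - A (2 * a), ?_, ?_, fun t ht => ?_, fun t ht => ?_, fun t ht => ?_,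
    fun t => ?_, fun t => ?_⟩
  · exact contDiff_infty_iff_deriv.2 ⟨fun t => (hd t).differentiableAt, hd' ▸ hσ⟩
  · have h0 : 0 ≤ A (2 * a) := intervalIntegral.integral_nonneg (by linarith)
      fun s _ => Real.smoothTransition.nonneg _
    have h1 : A (2 * a) ≤ 2 * a := by
      have h2 := intervalIntegral.integral_mono_on (a := 0) (b := 2 * a) (by linarith)
        (hint 0 (2 * a)) (intervalIntegrable_const (c := (1 : ℝ)))
        fun s _ => Real.smoothTransition.le_one _
      simpa using h2
    rw [abs_le]
    constructor <;> linarith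
  · have : A t = ∫ s in (0 : ℝ)..t, (0 : ℝ) := by
      refine intervalIntegral.integral_congr fun s hs => hσ0 s ?_
      rcases Set.mem_uIcc.1 hs with h | h <;> linarith [h.1, h.2]
    simpa using this
  · have h1 : A t = A (2 * a) + ∫ s in (2 * a)..t, σ s :=
      (intervalIntegral.integral_add_adjacent_intervals (hint _ _) (hint _ _)).symm
    have h2 : ∫ s in (2 * a)..t, σ s = ∫ s in (2 * a)..t, (1 : ℝ) := by
      refine intervalIntegral.integral_congr fun s hs => hσ1 s ?_
      rw [Set.uIcc_of_le ht] at hs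
      exact hs.1
    rw [h1, h2]
    simp
    ring
  · rw [hd', hσ1 t ht]
  · rw [hd']; exact Real.smoothTransition.nonneg _
  · rw [hd']; exact hmono.deriv_nonneg

end KahlerCone

namespace KahlerCone

variable {m : ℕ}

/-! ### Gluing strictly plurisubharmonic functions to the cone metric -/

theorem levi_smul (f : Cn m → ℝ) (z v : Cn m) (t : ℝ) :
    levi f z (t • v) = t ^ 2 * levi f z v := by
  simp only [levi, secondDeriv, map_smul, smul_apply, smul_eq_mul]
  ring

theorem continuousOn_fderiv_fderiv {f : Cn m → ℝ} {Y : Set (Cn m)} (hY : IsOpen Y)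
    (hf : ContDiffOn ℝ ∞ f Y) : ContinuousOn (fderiv ℝ (fderiv ℝ f)) Y :=
  ((hf.fderiv_of_isOpen (m := ∞) hY le_rfl).fderiv_of_isOpen (m := ∞) hY le_rfl).continuousOn

theorem exists_levi_bound {f : Cn m → ℝ} {Y K : Set (Cn m)} (hY : IsOpen Y)
    (hf : ContDiffOn ℝ ∞ f Y) (hK : IsCompact K) (hKY : K ⊆ Y) :
    ∃ M : ℝ, 0 < M ∧ ∀ z ∈ K, ∀ v, |levi f z v| ≤ M * ‖v‖ ^ 2 := by
  obtain ⟨C, hC⟩ := hK.exists_bound_of_continuousOn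
    (f := fderiv ℝ (fderiv ℝ f)) ((continuousOn_fderiv_fderiv hY hf).mono hKY)
  refine ⟨2 * |C| + 1, by positivity, fun z hz v => ?_⟩
  have h : ∀ w : Cn m, |secondDeriv f z w| ≤ |C| * ‖w‖ ^ 2 := fun w => by
    have h1 : ‖fderiv ℝ (fderiv ℝ f) z w w‖ ≤ ‖fderiv ℝ (fderiv ℝ f) z‖ * ‖w‖ * ‖w‖ :=
      ContinuousLinearMap.le_opNorm₂ _ w w
    calc |secondDeriv f z w| ≤ ‖fderiv ℝ (fderiv ℝ f) z‖ * ‖w‖ * ‖w‖ := h1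
      _ ≤ |C| * ‖w‖ * ‖w‖ := by
        gcongr
        exact (hC z hz).trans (le_abs_self C)
      _ = _ := by ring
  have h1 := h v
  have h2 := h (J m v)
  rw [norm_J] at h2
  calc |levi f z v| ≤ |secondDeriv f z v| + |secondDeriv f z (J m v)| := abs_add_le _ _
    _ ≤ _ := by nlinarith [sq_nonneg ‖v‖]

/-- Compactness of `K` times the unit sphere gives the bound for unit vectors, and homogeneity of
degree two gives it for all `v`. -/
theorem exists_levi_lower_bound {f : Cn m → ℝ} {Y K : Set (Cn m)} (hY : IsOpen Y)
    (hf : IsStrictlyPSHOn f Y) (hK : IsCompact K) (hKY : K ⊆ Y) :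
    ∃ c : ℝ, 0 < c ∧ ∀ z ∈ K, ∀ v, c * ‖v‖ ^ 2 ≤ levi f z v := by
  have hcont : ContinuousOn (fun q : Cn m × Cn m => levi f q.1 q.2)
      (K ×ˢ Metric.sphere (0 : Cn m) 1) := by
    have h1 : ContinuousOn (fun q : Cn m × Cn m => fderiv ℝ (fderiv ℝ f) q.1)
        (K ×ˢ Metric.sphere (0 : Cn m) 1) :=
      ((continuousOn_fderiv_fderiv hY hf.smooth).mono hKY).comp continuousOn_fst
        fun q hq => hq.1
    have h2 : ContinuousOn (fun q : Cn m × Cn m => J m q.2)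
        (K ×ˢ Metric.sphere (0 : Cn m) 1) := (J m).continuous.comp_continuousOn continuousOn_snd
    exact ((h1.clm_apply continuousOn_snd).clm_apply continuousOn_snd).add
      ((h1.clm_apply h2).clm_apply h2)
  obtain ⟨c, hc, hle⟩ := (hK.prod (isCompact_sphere (0 : Cn m) 1)).exists_forall_le' hcont
    (a := 0) fun q hq => by
      have hv : q.2 ≠ 0 := by
        intro h
        have := hq.2
        rw [h] at this
        simp at this
      have h3 := hf.pos q.1 (hKY hq.1) q.2 hv
      rwa [ddc_apply_J ((hf.smooth.contDiffAt (hY.mem_nhds (hKY hq.1))).of_le two_le_infty)] at h3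
  refine ⟨c, hc, fun z hz v => ?_⟩
  by_cases hv : v = 0
  · simp [hv, levi, secondDeriv]
  have hv' := norm_pos_iff.2 hv
  have h4 := hle (z, ‖v‖⁻¹ • v) ⟨hz, by
    rw [mem_sphere_zero_iff_norm, norm_smul, norm_inv, norm_norm, inv_mul_cancel₀ hv'.ne']⟩
  simp only [levi_smul] at h4
  rw [inv_pow, inv_mul_eq_div, le_div_iff₀ (by positivity)] at h4
  exact h4

/-- The mean value inequality, used twice: a bound on the second derivative gives `dp = O(‖z‖)`, and
that gives `p = O(‖z‖²)`. -/
theorem exists_quadratic_bounds {p : Cn m → ℝ} {U : Set (Cn m)} (hU : IsOpen U)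
    (hp : ContDiffOn ℝ ∞ p U) (hp0 : p 0 = 0) (hdp0 : fderiv ℝ p 0 = 0) {ρ : ℝ}
    (hρ : Metric.closedBall (0 : Cn m) ρ ⊆ U) :
    ∃ C : ℝ, 0 < C ∧ ∀ z ∈ Metric.closedBall (0 : Cn m) ρ, |p z| ≤ C * ‖z‖ ^ 2 ∧
      ∀ v, |fderiv ℝ p z v| ≤ C * ‖z‖ * ‖v‖ := by
  obtain ⟨C, hC⟩ := (isCompact_closedBall (0 : Cn m) ρ).exists_bound_of_continuousOn
    (f := fderiv ℝ (fderiv ℝ p)) ((continuousOn_fderiv_fderiv hU hp).mono hρ)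
  have hC' : ∀ x ∈ Metric.closedBall (0 : Cn m) ρ, ‖fderiv ℝ (fderiv ℝ p) x‖ ≤ |C| + 1 :=
    fun x hx => (hC x hx).trans (by linarith [le_abs_self C])
  have hcd : ∀ x ∈ U, ContDiffAt ℝ 2 p x := fun x hx =>
    (hp.contDiffAt (hU.mem_nhds hx)).of_le two_le_infty
  have h1 : ∀ z ∈ Metric.closedBall (0 : Cn m) ρ, ‖fderiv ℝ p z‖ ≤ (|C| + 1) * ‖z‖ := by
    intro z hz
    have h0 : (0 : Cn m) ∈ Metric.closedBall (0 : Cn m) ρ :=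
      Metric.mem_closedBall_self (dist_nonneg.trans hz)
    have := (convex_closedBall (0 : Cn m) ρ).norm_image_sub_le_of_norm_fderiv_le (𝕜 := ℝ)
      (fun x hx => differentiableAt_fderiv (hcd x (hρ hx))) hC' h0 hz
    simpa [hdp0] using this
  refine ⟨|C| + 1, by positivity, fun z hz => ⟨?_, fun v => ?_⟩⟩
  -- Working on the ball of radius `‖z‖` makes `C ‖z‖` a uniform bound for the gradient there.
  · have hsub : Metric.closedBall (0 : Cn m) ‖z‖ ⊆ Metric.closedBall (0 : Cn m) ρ :=
      Metric.closedBall_subset_closedBall (mem_closedBall_zero_iff.1 hz)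
    have := (convex_closedBall (0 : Cn m) ‖z‖).norm_image_sub_le_of_norm_fderiv_le (𝕜 := ℝ)
      (C := (|C| + 1) * ‖z‖)
      (fun x hx => (hcd x (hρ (hsub hx))).differentiableAt two_ne_zero)
      (fun x hx => (h1 x (hsub hx)).trans (by
        have := mem_closedBall_zero_iff.1 hx
        gcongr))
      (Metric.mem_closedBall_self (norm_nonneg z)) (y := z) (by simp)
    rw [hp0, sub_zero, sub_zero, Real.norm_eq_abs] at this
    calc |p z| ≤ _ := this
      _ = _ := by ring
  · exact ((fderiv ℝ p z).le_opNorm v).trans (by gcongr; exact h1 z hz)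

/-- Interpolating, by a logarithmic cutoff of `‖z‖²`, between a strictly plurisubharmonic function
vanishing to second order and `‖z‖² - K` preserves strict plurisubharmonicity. -/
theorem levi_interpolation_pos {p : Cn m → ℝ} {ψ : ℝ → ℝ} {z : Cn m} {b c C K : ℝ} (hz : z ≠ 0)
    (hp : ContDiffAt ℝ 2 p z) (hψ : ContDiffAt ℝ 2 ψ (‖z‖ ^ 2)) (hψ0 : 0 ≤ ψ (‖z‖ ^ 2))
    (hψ1 : ψ (‖z‖ ^ 2) ≤ 1) (hb : 0 < b) (hC : 0 < C) (hc : c ≤ 4)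
    (hψ' : |deriv ψ (‖z‖ ^ 2)| ≤ b / ‖z‖ ^ 2)
    (hψ'' : |deriv (deriv ψ) (‖z‖ ^ 2)| ≤ 2 * b / (‖z‖ ^ 2) ^ 2)
    (hpC : |p z| ≤ C * ‖z‖ ^ 2) (hdp : ∀ v, |fderiv ℝ p z v| ≤ C * ‖z‖ * ‖v‖)
    (hL : ∀ v, c * ‖v‖ ^ 2 ≤ levi p z v) (hK : |K| ≤ ‖z‖ ^ 2) (hsmall : 28 * b * (2 + C) < c)
    {v : Cn m} (hv : v ≠ 0) :
    0 < levi (fun x => p x + ψ (‖x‖ ^ 2) * (‖x‖ ^ 2 - K - p x)) z v := by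
  have hz' := norm_pos_iff.2 hz
  have hv' := norm_pos_iff.2 hv
  have hN : ContDiffAt ℝ 2 (fun x : Cn m => ‖x‖ ^ 2) z := contDiff_normSq.contDiffAt
  have hχ : ContDiffAt ℝ 2 (fun x : Cn m => ψ (‖x‖ ^ 2)) z := hψ.comp z hN
  have hNK : ContDiffAt ℝ 2 (fun x : Cn m => ‖x‖ ^ 2 - K) z := hN.sub contDiffAt_const
  have hu : ContDiffAt ℝ 2 (fun x : Cn m => ‖x‖ ^ 2 - K - p x) z := hNK.sub hp
  have hdχ : ∀ w, |fderiv ℝ (fun x : Cn m => ψ (‖x‖ ^ 2)) z w| ≤ 2 * b / ‖z‖ * ‖w‖ := by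
    intro w
    have h3 : HasFDerivAt (fun x : Cn m => ψ (‖x‖ ^ 2))
        (deriv ψ (‖z‖ ^ 2) • fderiv ℝ (fun x : Cn m => ‖x‖ ^ 2) z) z :=
      HasDerivAt.comp_hasFDerivAt (f := fun x : Cn m => ‖x‖ ^ 2) z
        (hψ.differentiableAt two_ne_zero).hasDerivAt (hN.differentiableAt two_ne_zero).hasFDerivAt
    rw [h3.fderiv, smul_apply, smul_eq_mul, abs_mul]
    calc _ ≤ b / ‖z‖ ^ 2 * (2 * ‖z‖ * ‖w‖) := by
          gcongr
          exact abs_fderiv_normSq_le z w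
      _ = _ := by field_simp
  have hdu : ∀ w, |fderiv ℝ (fun x : Cn m => ‖x‖ ^ 2 - K - p x) z w| ≤
      (2 + C) * ‖z‖ * ‖w‖ := by
    intro w
    rw [fderiv_fun_sub (hNK.differentiableAt two_ne_zero) (hp.differentiableAt two_ne_zero),
      fderiv_sub_const, sub_apply]
    have := abs_sub (fderiv ℝ (fun x : Cn m => ‖x‖ ^ 2) z w) (fderiv ℝ p z w)
    linarith [abs_fderiv_normSq_le z w, hdp w]
  have hu0 : |‖z‖ ^ 2 - K - p z| ≤ (2 + C) * ‖z‖ ^ 2 := by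
    have h1 := abs_le.1 hpC
    have h2 := abs_le.1 hK
    rw [abs_le]
    constructor <;> nlinarith [sq_nonneg ‖z‖]
  have hlu : levi (fun x : Cn m => ‖x‖ ^ 2 - K - p x) z v = 4 * ‖v‖ ^ 2 - levi p z v := by
    rw [levi_sub hNK hp, levi_sub hN contDiffAt_const, levi_normSq]
    simp [levi, secondDeriv]
  -- `20 = 16 + 4`: the second derivative of `ψ` contributes `2b/N² · 8N`, the first `b/N · 4`, with
  -- `N = ‖z‖²`.
  have hlχ : |levi (fun x : Cn m => ψ (‖x‖ ^ 2)) z v| ≤ 20 * b / ‖z‖ ^ 2 * ‖v‖ ^ 2 := by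
    rw [levi_comp hψ hN, levi_normSq]
    have hsq : ∀ w : Cn m, ‖w‖ = ‖v‖ →
        fderiv ℝ (fun x : Cn m => ‖x‖ ^ 2) z w ^ 2 ≤ 4 * ‖z‖ ^ 2 * ‖v‖ ^ 2 := by
      intro w hw
      have h1 := abs_fderiv_normSq_le z w
      rw [hw] at h1
      calc _ = |fderiv ℝ (fun x : Cn m => ‖x‖ ^ 2) z w| ^ 2 := (sq_abs _).symm
        _ ≤ (2 * ‖z‖ * ‖v‖) ^ 2 := by gcongr
        _ = _ := by ring
    have h1 := hsq v rfl
    have h2 := hsq (J m v) (norm_J v)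
    calc _ ≤ |deriv (deriv ψ) (‖z‖ ^ 2)| * (fderiv ℝ (fun x : Cn m => ‖x‖ ^ 2) z v ^ 2 +
            fderiv ℝ (fun x : Cn m => ‖x‖ ^ 2) z (J m v) ^ 2) +
            |deriv ψ (‖z‖ ^ 2)| * (4 * ‖v‖ ^ 2) := by
          refine (abs_add_le _ _).trans (le_of_eq ?_)
          rw [abs_mul, abs_mul, abs_of_nonneg (by positivity : 0 ≤ 4 * ‖v‖ ^ 2),
            abs_of_nonneg (a := _ ^ 2 + _ ^ 2) (add_nonneg (sq_nonneg _) (sq_nonneg _))]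
      _ ≤ 2 * b / (‖z‖ ^ 2) ^ 2 * (4 * ‖z‖ ^ 2 * ‖v‖ ^ 2 + 4 * ‖z‖ ^ 2 * ‖v‖ ^ 2) +
            b / ‖z‖ ^ 2 * (4 * ‖v‖ ^ 2) := by gcongr
      _ = _ := by field_simp; ring
  rw [levi_add hp (hχ.mul hu), levi_mul hχ hu, hlu]
  set χ := ψ (‖z‖ ^ 2)
  have hcross : ∀ w : Cn m, ‖w‖ = ‖v‖ → |fderiv ℝ (fun x : Cn m => ψ (‖x‖ ^ 2)) z w *
      fderiv ℝ (fun x : Cn m => ‖x‖ ^ 2 - K - p x) z w| ≤ 2 * b * (2 + C) * ‖v‖ ^ 2 := by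
    intro w hw
    rw [abs_mul]
    calc _ ≤ (2 * b / ‖z‖ * ‖w‖) * ((2 + C) * ‖z‖ * ‖w‖) := by
          gcongr
          · exact hdχ w
          · exact hdu w
      _ = _ := by rw [hw]; field_simp
  have h1 := (abs_le.1 (hcross v rfl)).1
  have h2 := (abs_le.1 (hcross (J m v) (norm_J v))).1
  have h3 : |(‖z‖ ^ 2 - K - p z) * levi (fun x : Cn m => ψ (‖x‖ ^ 2)) z v| ≤
      20 * b * (2 + C) * ‖v‖ ^ 2 := by
    rw [abs_mul]
    calc _ ≤ ((2 + C) * ‖z‖ ^ 2) * (20 * b / ‖z‖ ^ 2 * ‖v‖ ^ 2) := by gcongr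
      _ = _ := by field_simp
  have h4 := (abs_le.1 h3).1
  -- The main term is a convex combination of two Levi forms bounded below by `c ‖v‖²`; `c ≤ 4`
  -- serves the one of `‖z‖²`.
  have h5 : c * ‖v‖ ^ 2 ≤ (1 - χ) * levi p z v + χ * (4 * ‖v‖ ^ 2) := by
    have e1 : (1 - χ) * (c * ‖v‖ ^ 2) ≤ (1 - χ) * levi p z v :=
      mul_le_mul_of_nonneg_left (hL v) (by linarith)
    have e2 : χ * (c * ‖v‖ ^ 2) ≤ χ * (4 * ‖v‖ ^ 2) := by gcongr
    linarith
  -- `28 = 8 + 20`: the two cross terms contribute `2 · (2 + 2)`, the Levi form of the cutoff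
  -- contributes `20`.
  have h6 : 28 * b * (2 + C) * ‖v‖ ^ 2 < c * ‖v‖ ^ 2 :=
    mul_lt_mul_of_pos_right hsmall (by positivity)
  linarith

end KahlerCone

namespace KahlerCone

variable {m : ℕ}

/-! ### The gluing of strictly plurisubharmonic functions. -/

theorem IsStrictlyPSHOn.levi_pos {p : Cn m → ℝ} {U : Set (Cn m)} (hU : IsOpen U)
    (hp : IsStrictlyPSHOn p U) {z : Cn m} (hz : z ∈ U) {v : Cn m} (hv : v ≠ 0) :
    0 < levi p z v := by
  rw [← ddc_apply_J ((hp.smooth.contDiffAt (hU.mem_nhds hz)).of_le two_le_infty)]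
  exact hp.pos z hz v hv

theorem exists_isStrictlyPSHOn_eq_radius_sq {lam : Fin m → ℝ} (hlam : ∀ a, 0 < lam a)
    {U : Set (Cn m)} (hU : IsOpen U) (hU0 : (0 : Cn m) ∈ U) {p : Cn m → ℝ}
    (hp : IsStrictlyPSHOn p U) (hp0 : p 0 = 0) (hdp0 : fderiv ℝ p 0 = 0) :
    ∃ ε : ℝ, 0 < ε ∧ ∃ q : Cn m → ℝ, IsStrictlyPSHOn q (U \ {0}) ∧
      ∃ V W : Set (Cn m), IsOpen V ∧ IsOpen W ∧ (0 : Cn m) ∈ W ∧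
        closure W ⊆ V ∧ IsCompact (closure V) ∧ closure V ⊆ U ∧
        (∀ z ∈ U \ V, q z = p z) ∧
        (∀ z ∈ W \ {0}, q z = ε * radius lam z ^ 2) := by
  obtain ⟨ρ, hρ, hρU⟩ := Metric.nhds_basis_closedBall.mem_iff.1 (hU.mem_nhds hU0)
  obtain ⟨c₀, hc₀, hlow⟩ := exists_levi_lower_bound hU hp (isCompact_closedBall 0 ρ) hρU
  obtain ⟨C, hC, hquad⟩ := exists_quadratic_bounds hU hp.smooth hp0 hdp0 hρU
  obtain ⟨B, hB, hcut⟩ := exists_log_cutoff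
  set c := min c₀ 4
  have hc : 0 < c := lt_min hc₀ (by norm_num)
  -- Chosen so that `b = B / L` meets the smallness condition of `levi_interpolation_pos`.
  set L := max 1 (28 * B * (2 + C) / c + 1)
  have hL1 : 1 ≤ L := le_max_left _ _
  have hL0 : 0 < L := by linarith
  have hsmall : 28 * (B / L) * (2 + C) < c := by
    have h1 : 28 * B * (2 + C) / c < L := lt_of_lt_of_le (lt_add_one _) (le_max_right _ _)
    rw [div_lt_iff₀ hc] at h1
    calc 28 * (B / L) * (2 + C) = 28 * B * (2 + C) / L := by ring
      _ < c := by rw [div_lt_iff₀ hL0]; linarith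
  -- Makes the logarithmic window for `‖z‖²` equal to `[4a, ρ²]`, which leaves `[a, 3a]` free for
  -- the ramp `A` and the cutoff `ψ₂` of the cone metric.
  set a := ρ ^ 2 * Real.exp (-L) / 4 with ha_def
  have ha : 0 < a := by positivity
  have haL : 4 * a * Real.exp L = ρ ^ 2 := by
    rw [ha_def, mul_div_cancel₀ _ (by norm_num), mul_assoc, ← Real.exp_add]
    simp
  have haρ : 4 * a ≤ ρ ^ 2 := by
    rw [← haL]
    exact le_mul_of_one_le_right (by positivity) (Real.one_le_exp hL0.le)
  obtain ⟨ψ, hψs, hψ01, hψ1, hψ0, hψ', hψ''⟩ := hcut (4 * a) L (by positivity) hL1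
  rw [haL] at hψ0
  obtain ⟨A, K, hAs, hK, hA0, hA2, hA2', hA', hA''⟩ := exists_convex_ramp ha
  set ψ₂ : ℝ → ℝ := fun t => 1 - Real.smoothTransition ((t - 2 * a) / a) with hψ₂
  have hψ₂s : ContDiff ℝ ∞ ψ₂ := contDiff_const.sub
    (Real.smoothTransition.contDiff.comp ((contDiff_id.sub contDiff_const).div_const a))
  have hψ₂1 : ∀ t ≤ 2 * a, ψ₂ t = 1 := fun t ht => by
    simp [hψ₂, Real.smoothTransition.zero_of_nonpos
      (div_nonpos_of_nonpos_of_nonneg (by linarith : t - 2 * a ≤ 0) ha.le)]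
  have hψ₂0 : ∀ t, 3 * a ≤ t → ψ₂ t = 0 := fun t ht => by
    simp [hψ₂, Real.smoothTransition.one_of_one_le
      ((one_le_div ha).2 (by linarith : a ≤ t - 2 * a))]
  have hr := contDiffOn_radius_sq hlam
  set g : Cn m → ℝ := fun z => ψ₂ (‖z‖ ^ 2) * radius lam z ^ 2 with hg_def
  have hg : ContDiffOn ℝ ∞ g {0}ᶜ := (hψ₂s.comp contDiff_normSq).contDiffOn.mul hr
  have hopen0 : IsOpen ({0}ᶜ : Set (Cn m)) := isOpen_compl_singleton
  have hNc : Continuous fun z : Cn m => ‖z‖ ^ 2 := by fun_prop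
  -- On the shell where `ψ₂` varies, the Levi form of the cut-off `r_λ²` is at most `M ‖v‖²` in
  -- absolute value. Dividing by `M` leaves an error of at most `‖v‖²`, against the `4 ‖v‖²`
  -- supplied by `A`.
  obtain ⟨M, hM, hMb⟩ := exists_levi_bound (K := {z : Cn m | 2 * a ≤ ‖z‖ ^ 2 ∧ ‖z‖ ^ 2 ≤ 3 * a})
    hopen0 hg (by
      refine (isCompact_closedBall (0 : Cn m) ρ).of_isClosed_subset
        ((isClosed_le continuous_const hNc).inter (isClosed_le hNc continuous_const))
        fun z hz => ?_
      rw [mem_closedBall_zero_iff]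
      exact abs_le_of_sq_le_sq' (by linarith [hz.2]) hρ.le |>.2) (by
      rintro z hz (rfl : z = 0)
      have := hz.1
      rw [norm_zero] at this
      linarith)
  refine ⟨M⁻¹, inv_pos.2 hM, fun z => p z + ψ (‖z‖ ^ 2) * (A (‖z‖ ^ 2) - p z) + M⁻¹ * g z, ?_,
    Metric.ball 0 ρ, {z | ‖z‖ ^ 2 < a}, Metric.isOpen_ball, isOpen_lt hNc continuous_const,
    by simpa using ha, ?_, ?_, ?_, ?_, ?_⟩
  · refine isStrictlyPSHOn_of_levi (hU.sdiff isClosed_singleton) ?_ ?_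
    · have hp' : ContDiffOn ℝ ∞ p (U \ {0}) := hp.smooth.mono Set.sdiff_subset
      have hψN : ContDiffOn ℝ ∞ (fun z : Cn m => ψ (‖z‖ ^ 2)) (U \ {0}) := fun z hz =>
        ((hψs _ (by have := norm_pos_iff.2 hz.2; positivity)).comp z
          contDiff_normSq.contDiffAt).contDiffWithinAt
      exact (hp'.add (hψN.mul ((hAs.comp contDiff_normSq).contDiffOn.sub hp'))).add
        (contDiffOn_const.mul (hg.mono fun z hz => hz.2))
    · rintro z ⟨hzU, hz0 : z ≠ 0⟩ v hv
      have hz' := norm_pos_iff.2 hz0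
      have hv' := norm_pos_iff.2 hv
      have hN2 : ContDiffAt ℝ 2 (fun x : Cn m => ‖x‖ ^ 2) z := contDiff_normSq.contDiffAt
      have hA2d : ContDiffAt ℝ 2 A (‖z‖ ^ 2) := hAs.contDiffAt.of_le two_le_infty
      have hAN : ContDiffAt ℝ 2 (fun x : Cn m => A (‖x‖ ^ 2)) z := hA2d.comp z hN2
      have hr2 : ContDiffAt ℝ 2 (fun x => radius lam x ^ 2) z :=
        (hr.contDiffAt (hopen0.mem_nhds hz0)).of_le two_le_infty
      have hg2 : ContDiffAt ℝ 2 g z :=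
        (hg.contDiffAt (hopen0.mem_nhds hz0)).of_le two_le_infty
      have hAlevi : deriv A (‖z‖ ^ 2) * (4 * ‖v‖ ^ 2) ≤ levi (fun x => A (‖x‖ ^ 2)) z v := by
        rw [levi_comp hA2d hN2, levi_normSq]
        have := mul_nonneg (hA'' (‖z‖ ^ 2))
          (add_nonneg (sq_nonneg (fderiv ℝ (fun x : Cn m => ‖x‖ ^ 2) z v))
            (sq_nonneg (fderiv ℝ (fun x : Cn m => ‖x‖ ^ 2) z (J m v))))
        linarith
      have hM' : 0 < M⁻¹ := inv_pos.2 hM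
      -- Inner region: `q` is the plurisubharmonic `A(‖z‖²)` plus a positive multiple of `r_λ²`.
      rcases lt_or_ge (‖z‖ ^ 2) (2 * a) with h2 | h2
      · have heq : (fun x => p x + ψ (‖x‖ ^ 2) * (A (‖x‖ ^ 2) - p x) + M⁻¹ * g x) =ᶠ[𝓝 z]
            fun x => A (‖x‖ ^ 2) + M⁻¹ * radius lam x ^ 2 := by
          filter_upwards [(isOpen_lt hNc continuous_const).mem_nhds h2, hopen0.mem_nhds hz0]
            with x hx (hx0 : x ≠ 0)
          have hx' : ‖x‖ ^ 2 < 2 * a := hx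
          have := norm_pos_iff.2 hx0
          rw [hψ1 _ (by positivity) (by linarith)]
          simp only [hg_def, hψ₂1 _ hx'.le]
          ring
        rw [levi_congr heq, levi_add hAN (contDiffAt_const.mul hr2), levi_const_mul hr2]
        have h3 := mul_pos hM' (levi_radius_sq_pos hlam hz0 hv)
        have h4 := mul_nonneg (hA' (‖z‖ ^ 2)) (by positivity : 0 ≤ 4 * ‖v‖ ^ 2)
        linarith
      -- Shell `[2a, 3a]`: the slope of `A` is `1`, so its Levi form dominates the error from `ψ₂`.
      rcases le_or_gt (‖z‖ ^ 2) (3 * a) with h3 | h3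
      · have heq : (fun x => p x + ψ (‖x‖ ^ 2) * (A (‖x‖ ^ 2) - p x) + M⁻¹ * g x) =ᶠ[𝓝 z]
            fun x => A (‖x‖ ^ 2) + M⁻¹ * g x := by
          filter_upwards [(isOpen_lt hNc continuous_const).mem_nhds
            (by linarith : ‖z‖ ^ 2 < 4 * a), hopen0.mem_nhds hz0] with x hx (hx0 : x ≠ 0)
          have hx' : ‖x‖ ^ 2 < 4 * a := hx
          have := norm_pos_iff.2 hx0
          rw [hψ1 _ (by positivity) hx'.le]
          ring
        rw [levi_congr heq, levi_add hAN (contDiffAt_const.mul hg2), levi_const_mul hg2]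
        rw [hA2' _ h2] at hAlevi
        have h4 := mul_le_mul_of_nonneg_left (abs_le.1 (hMb z ⟨h2, h3⟩ v)).1 hM'.le
        have h5 : M⁻¹ * -(M * ‖v‖ ^ 2) = -‖v‖ ^ 2 := by field_simp
        have h6 : 0 < ‖v‖ ^ 2 := by positivity
        linarith
      have h3' : ∀ᶠ x : Cn m in 𝓝 z, 3 * a < ‖x‖ ^ 2 :=
        (isOpen_lt continuous_const hNc).mem_nhds h3
      -- Beyond `3a` the cone term is gone. Up to `ρ²` the logarithmic interpolation is at work;
      -- outside, `q = p`.
      rcases le_or_gt (‖z‖ ^ 2) (ρ ^ 2) with h4 | h4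
      · have heq : (fun x => p x + ψ (‖x‖ ^ 2) * (A (‖x‖ ^ 2) - p x) + M⁻¹ * g x) =ᶠ[𝓝 z]
            fun x => p x + ψ (‖x‖ ^ 2) * (‖x‖ ^ 2 - K - p x) := by
          filter_upwards [h3'] with x hx
          rw [hA2 _ (by linarith)]
          simp [hg_def, hψ₂0 _ hx.le]
        have hzρ : z ∈ Metric.closedBall (0 : Cn m) ρ := by
          rw [mem_closedBall_zero_iff]
          exact (abs_le_of_sq_le_sq' h4 hρ.le).2
        have hN0 : 0 < ‖z‖ ^ 2 := by positivity
        rw [levi_congr heq]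
        exact levi_interpolation_pos (b := B / L) (c := c) (C := C) hz0
          ((hp.smooth.contDiffAt (hU.mem_nhds hzU)).of_le two_le_infty)
          ((hψs _ hN0).of_le two_le_infty) (hψ01 _).1 (hψ01 _).2 (by positivity) hC
          (min_le_right _ _) (hψ' _ hN0) (hψ'' _ hN0) (hquad z hzρ).1 (hquad z hzρ).2
          (fun w => (mul_le_mul_of_nonneg_right (min_le_left _ _) (sq_nonneg _)).trans
            (hlow z hzρ w)) (by linarith) hsmall hv
      · have heq : (fun x => p x + ψ (‖x‖ ^ 2) * (A (‖x‖ ^ 2) - p x) + M⁻¹ * g x) =ᶠ[𝓝 z] p := by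
          filter_upwards [h3', (isOpen_lt continuous_const hNc).mem_nhds h4] with x hx hx4
          rw [hψ0 _ (le_of_lt hx4)]
          simp [hg_def, hψ₂0 _ hx.le]
        rw [levi_congr heq]
        exact hp.levi_pos hU hzU hv
  · refine (closure_minimal (t := {z : Cn m | ‖z‖ ^ 2 ≤ a})
      (fun z (hz : ‖z‖ ^ 2 < a) => hz.le)
      (isClosed_le hNc continuous_const)).trans fun z hz => ?_
    rw [mem_ball_zero_iff]
    have hz' : ‖z‖ ^ 2 ≤ a := hz
    exact (abs_lt_of_sq_lt_sq' (by linarith) hρ.le).2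
  · exact (isCompact_closedBall (0 : Cn m) ρ).of_isClosed_subset isClosed_closure
      Metric.closure_ball_subset_closedBall
  · exact Metric.closure_ball_subset_closedBall.trans hρU
  · rintro z ⟨-, hz⟩
    rw [mem_ball_zero_iff, not_lt] at hz
    have h1 : ρ ^ 2 ≤ ‖z‖ ^ 2 := by gcongr
    simp [hg_def, hψ0 _ h1, hψ₂0 _ (by linarith : 3 * a ≤ ‖z‖ ^ 2)]
  · rintro z ⟨hz, hz0 : z ≠ 0⟩
    have hz' : ‖z‖ ^ 2 < a := hz
    have := norm_pos_iff.2 hz0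
    simp [hg_def, hψ1 _ (by positivity : 0 < ‖z‖ ^ 2) (by linarith), hA0 _ hz'.le,
      hψ₂1 _ (by linarith : ‖z‖ ^ 2 ≤ 2 * a)]

end KahlerCone

namespace KahlerCone

open MeasureTheory

/-! ### Smooth dependence of integrals on parameters -/

section Parametric

/-- Evaluating a convolution with reflected kernel at `0` makes the smoothness theorems for
convolutions with parameters apply to such integrals. -/
theorem integral_mul_eq_convolution {P G 𝔸 : Type*} [AddCommGroup G] [MeasurableSpace G]
    {μ : Measure G} [RCLike 𝔸] (f : G → 𝔸) (F : P → G → 𝔸) (p : P) :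
    ∫ t, f t * F p t ∂μ =
      convolution f (fun x => F p (-x)) (ContinuousLinearMap.mul ℝ 𝔸) μ 0 := by
  simp [convolution]

variable {P G 𝔸 : Type*} [NormedAddCommGroup P] [NormedSpace ℝ P] [NormedAddCommGroup G]
  [NormedSpace ℝ G] [MeasurableSpace G] [BorelSpace G] {μ : Measure G} [RCLike 𝔸]
  {f : G → 𝔸} {F : P → G → 𝔸}

/-- The weight `f` need only be locally integrable, which covers both the Cauchy kernel and the
indicator of `[0,1]`; all smoothness sits in `F`, whose support is compact locally uniformly in the
parameter. -/
theorem contDiff_integral_mul (hf : LocallyIntegrable f μ)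
    (hF : ContDiff ℝ ∞ (Function.uncurry F))
    (hs : ∀ p₀, ∃ s : Set P, IsOpen s ∧ p₀ ∈ s ∧ ∃ k : Set G, IsCompact k ∧
      ∀ p ∈ s, ∀ x ∉ k, F p x = 0) :
    ContDiff ℝ ∞ fun p => ∫ t, f t * F p t ∂μ := by
  rw [contDiff_iff_contDiffAt]
  intro p₀
  obtain ⟨s, hso, hp₀, k, hk, hF0⟩ := hs p₀
  simp only [integral_mul_eq_convolution]
  refine ContDiffOn.contDiffAt (s := s) ?_ (hso.mem_nhds hp₀)
  refine contDiffOn_convolution_right_with_param_comp (n := ⊤) (k := -k) (v := fun _ => (0 : G))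
    (g := fun p x => F p (-x)) (ContinuousLinearMap.mul ℝ 𝔸) contDiffOn_const hso hk.neg
    (fun p x hp hx => hF0 p hp _ (by simpa using hx)) hf ?_
  exact (hF.comp (contDiff_fst.prodMk contDiff_snd.neg)).contDiffOn

theorem fderiv_integral_mul (hf : LocallyIntegrable f μ)
    (hF : ContDiff ℝ ∞ (Function.uncurry F))
    (hs : ∀ p₀, ∃ s : Set P, IsOpen s ∧ p₀ ∈ s ∧ ∃ k : Set G, IsCompact k ∧
      ∀ p ∈ s, ∀ x ∉ k, F p x = 0) (p w : P) :
    fderiv ℝ (fun p => ∫ t, f t * F p t ∂μ) p w =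
      ∫ t, f t * fderiv ℝ (fun q => F q t) p w ∂μ := by
  obtain ⟨s, hso, hp, k, hk, hF0⟩ := hs p
  set g : P → G → 𝔸 := fun p x => F p (-x) with hg_def
  have hg : ContDiff ℝ ∞ (Function.uncurry g) :=
    hF.comp (contDiff_fst.prodMk contDiff_snd.neg)
  have hg0 : ∀ p x, p ∈ s → x ∉ -k → g p x = 0 :=
    fun p x hp hx => hF0 p hp _ (by simpa using hx)
  have h1 := hasFDerivAt_convolution_right_with_param (ContinuousLinearMap.mul ℝ 𝔸) hso hk.neg
    hg0 hf ((hg.of_le (by exact_mod_cast le_top)).contDiffOn) (p, (0 : G)) hp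
  have h2 : HasFDerivAt (fun q : P => (q, (0 : G))) (ContinuousLinearMap.inl ℝ P G) p :=
    hasFDerivAt_prodMk_left p 0
  have h3 := h1.comp p h2
  have e : (fun p => ∫ t, f t * F p t ∂μ) = (fun q : P × G =>
      convolution f (g q.1) (ContinuousLinearMap.mul ℝ 𝔸) μ q.2) ∘ fun q : P => (q, (0 : G)) := by
    ext q
    exact integral_mul_eq_convolution f F q
  have hcs : HasCompactSupport fun x => fderiv ℝ (Function.uncurry g) (p, x) := by
    refine HasCompactSupport.intro hk.neg fun x hx => ?_
    have : Function.uncurry g =ᶠ[𝓝 (p, x)] fun _ => 0 := by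
      filter_upwards [(hso.prod hk.neg.isClosed.isOpen_compl).mem_nhds ⟨hp, hx⟩] with y hy
      exact hg0 _ _ hy.1 hy.2
    rw [this.fderiv_eq]
    simp
  have hcont : Continuous fun x => fderiv ℝ (Function.uncurry g) (p, x) :=
    (hg.continuous_fderiv (by simp)).comp (Continuous.prodMk_right p)
  have hint := hcs.convolutionExists_right
    ((ContinuousLinearMap.mul ℝ 𝔸).precompR (P × G)) hf hcont 0
  rw [e, h3.fderiv, ContinuousLinearMap.comp_apply, convolution]
  erw [ContinuousLinearMap.integral_apply hint]
  refine integral_congr_ae (Filter.Eventually.of_forall fun t => ?_)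
  have h4 : HasFDerivAt (fun q => F q t)
      ((fderiv ℝ (Function.uncurry g) (p, -t)).comp (ContinuousLinearMap.inl ℝ P G)) p := by
    have h5 : HasFDerivAt (fun q : P => (q, -t)) (ContinuousLinearMap.inl ℝ P G) p :=
      hasFDerivAt_prodMk_left p (-t)
    have h6 := ((hg.differentiable (by simp) (p, -t)).hasFDerivAt).comp p h5
    refine h6.congr_of_eventuallyEq (Filter.Eventually.of_forall fun q => ?_)
    simp [hg_def]
  beta_reduce
  rw [h4.fderiv]
  simp [ContinuousLinearMap.precompR_apply]

end Parametric

/-! ### The Cauchy kernel -/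

/-- In polar coordinates the Jacobian `r` cancels the singularity `1/r`. -/
theorem locallyIntegrable_inv : LocallyIntegrable (fun ζ : ℂ => ζ⁻¹) := by
  rw [locallyIntegrable_iff]
  intro K hK
  obtain ⟨R, hR⟩ := hK.isBounded.subset_closedBall (0 : ℂ)
  refine IntegrableOn.mono_set ?_ hR
  have h1 : Integrable (fun ζ : ℂ => (Set.Iic R).indicator (fun y : ℝ => y⁻¹) ‖ζ‖) := by
    rw [integrable_fun_norm_addHaar]
    have h2 : IntegrableOn (fun _ : ℝ => (1 : ℝ)) (Set.Ioc 0 R) := by simp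
    refine (h2.integrable_indicator measurableSet_Ioc).integrableOn.congr_fun
      (fun y (hy : 0 < y) => ?_) measurableSet_Ioi
    by_cases hyR : y ≤ R
    · simp [hy, hyR, hy.ne']
    · simp [hyR]
  rw [← integrable_indicator_iff measurableSet_closedBall]
  refine h1.mono ((measurable_inv.indicator measurableSet_closedBall).aestronglyMeasurable)
    (Filter.Eventually.of_forall fun ζ => ?_)
  by_cases h : ‖ζ‖ ≤ R
  · simp [Set.indicator, h]
  · simp [Set.indicator, h]

theorem setIntegral_polar_of_support {X : ℝ × ℝ → ℂ} (hX : Continuous X) {R : ℝ}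
    (hR : ∀ r, R < r → ∀ θ, X (r, θ) = 0) :
    IntegrableOn X (Set.Ioi 0 ×ˢ Set.Ioo (-Real.pi) Real.pi) := by
  refine IntegrableOn.of_forall_sdiff_eq_zero (s := Set.Icc 0 R ×ˢ Set.Icc (-Real.pi) Real.pi)
    (hX.continuousOn.integrableOn_compact (isCompact_Icc.prod isCompact_Icc))
    (measurableSet_Ioi.prod measurableSet_Ioo) ?_
  rintro ⟨r, θ⟩ ⟨⟨hr, hθ⟩, h⟩
  refine hR r ?_ θ
  by_contra! hrR
  exact h ⟨⟨le_of_lt hr, hrR⟩, ⟨hθ.1.le, hθ.2.le⟩⟩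

/-- The Cauchy-Pompeiu formula for compactly supported functions. -/
theorem integral_inv_mul_dbar {h : ℂ → ℂ} (hh : ContDiff ℝ 1 h) (hc : HasCompactSupport h) :
    ∫ ζ : ℂ, ζ⁻¹ * (fderiv ℝ h ζ 1 + Complex.I * fderiv ℝ h ζ Complex.I) =
      -(2 * Real.pi * h 0) := by
  obtain ⟨R₀, hR₀⟩ := hc.isCompact.isBounded.subset_closedBall (0 : ℂ)
  set R := max R₀ 0
  have hsupp : ∀ ζ : ℂ, R < ‖ζ‖ → ζ ∉ tsupport h := fun ζ hζ hmem => by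
    have := mem_closedBall_zero_iff.1 (hR₀ hmem)
    exact absurd hζ (not_lt.2 (this.trans (le_max_left _ _)))
  set e : ℝ → ℂ := fun θ => Real.cos θ + Real.sin θ * Complex.I with he_def
  have hecont : Continuous e := by fun_prop
  have henorm : ∀ θ, ‖e θ‖ = 1 := fun θ => by
    rw [he_def]
    simp only [Complex.ofReal_cos, Complex.ofReal_sin]
    exact Complex.norm_cos_add_sin_mul_I θ
  have hdcont : Continuous (fderiv ℝ h) := hh.continuous_fderiv one_ne_zero
  have hd0 : ∀ ζ : ℂ, R < ‖ζ‖ → fderiv ℝ h ζ = 0 := fun ζ hζ => by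
    by_contra hne
    exact hsupp ζ hζ (support_fderiv_subset ℝ hne)
  have hnorm : ∀ r θ : ℝ, R < r → R < ‖(r : ℂ) * e θ‖ := fun r θ hr => by
    have hr0 : 0 < r := lt_of_le_of_lt (le_max_right _ _) hr
    rw [norm_mul, henorm, mul_one, Complex.norm_real, Real.norm_of_nonneg hr0.le]
    exact hr
  -- `X` is the radial derivative of `h`, and `r Y` its angular derivative. The Jacobian `r` cancels
  -- the modulus of the kernel, so the integrand becomes `X + i Y`.
  set X : ℝ × ℝ → ℂ := fun p => fderiv ℝ h (p.1 * e p.2) (e p.2) with hX_def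
  set Y : ℝ × ℝ → ℂ := fun p => fderiv ℝ h (p.1 * e p.2) (Complex.I * e p.2) with hY_def
  have hXc : Continuous X := by
    refine (hdcont.comp ?_).clm_apply ?_ <;> fun_prop
  have hYc : Continuous Y := by
    refine (hdcont.comp ?_).clm_apply ?_ <;> fun_prop
  have hX0 : ∀ r, R < r → ∀ θ, X (r, θ) = 0 := fun r hr θ => by
    simp [hX_def, hd0 _ (hnorm r θ hr)]
  have hY0 : ∀ r, R < r → ∀ θ, Y (r, θ) = 0 := fun r hr θ => by
    simp [hY_def, hd0 _ (hnorm r θ hr)]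
  have hXi := setIntegral_polar_of_support hXc hX0
  have hYi := setIntegral_polar_of_support hYc hY0
  have hpolar : ∀ p ∈ Set.Ioi (0 : ℝ) ×ˢ Set.Ioo (-Real.pi) Real.pi,
      p.1 • ((Complex.polarCoord.symm p)⁻¹ * (fderiv ℝ h (Complex.polarCoord.symm p) 1 +
        Complex.I * fderiv ℝ h (Complex.polarCoord.symm p) Complex.I)) =
      X p + Complex.I * Y p := by
    rintro ⟨r, θ⟩ ⟨hr, -⟩
    have hr' : (r : ℂ) ≠ 0 := Complex.ofReal_ne_zero.2 (ne_of_gt hr)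
    rw [Complex.polarCoord_symm_apply]
    have hlin : ∀ x y : ℝ, fderiv ℝ h (r * e θ) (x + y * Complex.I) =
        x * fderiv ℝ h (r * e θ) 1 + y * fderiv ℝ h (r * e θ) Complex.I := by
      intro x y
      have : (x + y * Complex.I : ℂ) = x • (1 : ℂ) + y • Complex.I := by simp
      rw [this, map_add, map_smul, map_smul]
      simp
    have h1 : X (r, θ) = Real.cos θ * fderiv ℝ h (r * e θ) 1 +
        Real.sin θ * fderiv ℝ h (r * e θ) Complex.I := hlin _ _
    have h2 : Y (r, θ) = -Real.sin θ * fderiv ℝ h (r * e θ) 1 +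
        Real.cos θ * fderiv ℝ h (r * e θ) Complex.I := by
      have : Complex.I * e θ = (-Real.sin θ : ℝ) + (Real.cos θ : ℝ) * Complex.I := by
        simp only [he_def]
        push_cast
        linear_combination (Complex.sin θ) * Complex.I_mul_I
      simp only [hY_def]
      rw [this, hlin]
      push_cast
      ring
    have he0 : e θ ≠ 0 := by
      rw [← norm_pos_iff, henorm]; exact one_pos
    have hinv : (Real.cos θ - Complex.I * Real.sin θ) * e θ = 1 := by
      simp only [he_def]
      push_cast
      linear_combination Complex.cos_sq_add_sin_sq (θ : ℂ) -
        (Complex.sin θ) ^ 2 * Complex.I_mul_I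
    change r • (((r : ℂ) * e θ)⁻¹ * (fderiv ℝ h (r * e θ) 1 +
        Complex.I * fderiv ℝ h (r * e θ) Complex.I)) = _
    rw [h1, h2, mul_inv, ← eq_inv_of_mul_eq_one_left hinv, Complex.real_smul]
    field_simp
    linear_combination (Real.sin θ : ℂ) * fderiv ℝ h (r * e θ) Complex.I * (-Complex.I_mul_I)
  -- Along each ray the integral of `X` is `0 - h 0`, by compact support; the angle contributes
  -- `2π`.
  have hXint : ∫ p in Set.Ioi (0 : ℝ) ×ˢ Set.Ioo (-Real.pi) Real.pi, X p =
      -(2 * Real.pi * h 0) := by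
    have hXi' : Integrable (Function.uncurry fun r θ => X (r, θ))
        ((volume.restrict (Set.Ioi (0 : ℝ))).prod
          (volume.restrict (Set.Ioo (-Real.pi) Real.pi))) := by
      rw [Measure.prod_restrict]
      exact hXi
    rw [Measure.volume_eq_prod] at hXi ⊢
    rw [setIntegral_prod _ hXi, integral_integral_swap hXi']
    have hinner : ∀ θ : ℝ, ∫ r in Set.Ioi (0 : ℝ), X (r, θ) = -h 0 := by
      intro θ
      have hderiv : ∀ r ∈ Set.Ici (0 : ℝ), HasDerivAt (fun r : ℝ => h (r * e θ)) (X (r, θ)) r := by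
        intro r _
        have h3 : HasDerivAt (fun r : ℝ => (r : ℂ) * e θ) (e θ) r := by
          simpa using (Complex.ofRealCLM.hasDerivAt (x := r)).mul_const (e θ)
        exact ((hh.differentiable one_ne_zero _).hasFDerivAt).comp_hasDerivAt r h3
      have hint : IntegrableOn (fun r => X (r, θ)) (Set.Ioi 0) := by
        refine IntegrableOn.of_forall_sdiff_eq_zero (s := Set.Icc 0 R)
          ((hXc.comp (Continuous.prodMk_left θ)).continuousOn.integrableOn_compact isCompact_Icc)
          measurableSet_Ioi ?_
        rintro r ⟨hr, h⟩
        refine hX0 r ?_ θ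
        by_contra! hrR
        exact h ⟨le_of_lt hr, hrR⟩
      have hlim : Filter.Tendsto (fun r : ℝ => h (r * e θ)) Filter.atTop (𝓝 0) := by
        refine tendsto_const_nhds.congr' ?_
        filter_upwards [Filter.eventually_gt_atTop R] with r hr
        exact (image_eq_zero_of_notMem_tsupport (hsupp _ (hnorm r θ hr))).symm
      rw [integral_Ioi_of_hasDerivAt_of_tendsto' hderiv hint hlim]
      simp
    simp only [hinner]
    simp
    left
    rw [max_eq_left (by positivity)]
    push_cast
    ring
  -- On each circle `r Y` is the derivative of a periodic function.
  have hYint : ∫ p in Set.Ioi (0 : ℝ) ×ˢ Set.Ioo (-Real.pi) Real.pi, Y p = 0 := by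
    rw [Measure.volume_eq_prod] at hYi ⊢
    rw [setIntegral_prod _ hYi]
    rw [setIntegral_congr_fun (g := fun _ => (0 : ℂ)) measurableSet_Ioi]
    · simp
    intro r (hr : 0 < r)
    have hderiv : ∀ θ : ℝ, HasDerivAt (fun θ : ℝ => h (r * e θ)) (r • Y (r, θ)) θ := by
      intro θ
      have h4 : HasDerivAt e (Complex.I * e θ) θ := by
        have h5 := (Real.hasDerivAt_cos θ).ofReal_comp.add
          ((Real.hasDerivAt_sin θ).ofReal_comp.mul_const Complex.I)
        refine h5.congr_deriv ?_
        simp only [he_def]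
        push_cast
        linear_combination -(Complex.sin θ) * Complex.I_mul_I
      have h6 := ((hh.differentiable one_ne_zero (r * e θ)).hasFDerivAt).comp_hasDerivAt θ
        (h4.const_mul (r : ℂ))
      refine h6.congr_deriv ?_
      simp only [hY_def]
      rw [← map_smul, Complex.real_smul]
    have hcont : Continuous fun θ => r • Y (r, θ) := by fun_prop
    have h7 : ∫ θ in (-Real.pi)..Real.pi, r • Y (r, θ) = 0 := by
      rw [intervalIntegral.integral_eq_sub_of_hasDerivAt (fun θ _ => hderiv θ)
        (hcont.intervalIntegrable _ _)]
      simp [he_def]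
    rw [intervalIntegral.integral_smul, smul_eq_zero] at h7
    have h8 := h7.resolve_left hr.ne'
    rw [intervalIntegral.integral_of_le (by linarith [Real.pi_pos])] at h8
    exact integral_Ioc_eq_integral_Ioo.symm.trans h8
  rw [← Complex.integral_comp_polarCoord_symm]
  change ∫ p in Set.Ioi (0 : ℝ) ×ˢ Set.Ioo (-Real.pi) Real.pi, _ = _
  rw [setIntegral_congr_fun (measurableSet_Ioi.prod measurableSet_Ioo) hpolar,
    integral_add hXi (hYi.const_mul _), integral_const_mul, hXint, hYint]
  simp

end KahlerCone

namespace KahlerCone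

open MeasureTheory

variable {m : ℕ}

/-! ### The local solution of the `∂̄`-equation -/

/-- The coordinate vector `e_k` of `ℂ^m`. -/
noncomputable def coordVec (k : Fin m) : Cn m := EuclideanSpace.single k (1 : ℂ)

@[simp] theorem coordVec_self (k : Fin m) : coordVec k k = 1 := by simp [coordVec]

theorem coordVec_of_ne {j k : Fin m} (h : j ≠ k) : coordVec j k = 0 := by
  simp [coordVec, h.symm]

theorem norm_coordVec (k : Fin m) : ‖coordVec k‖ = 1 := by simp [coordVec]

/-- Twice the derivative `∂f / ∂z̄_k`. -/
noncomputable def dbar (f : Cn m → ℂ) (k : Fin m) (z : Cn m) : ℂ :=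
  fderiv ℝ f z (coordVec k) + Complex.I * fderiv ℝ f z (Complex.I • coordVec k)

theorem contDiff_dbar {f : Cn m → ℂ} (hf : ContDiff ℝ ∞ f) (k : Fin m) :
    ContDiff ℝ ∞ (dbar f k) := by
  have h : ContDiff ℝ ∞ (fderiv ℝ f) := hf.fderiv_right (m := ∞) le_rfl
  exact (h.clm_apply contDiff_const).add (contDiff_const.mul (h.clm_apply contDiff_const))

theorem dbar_add {f g : Cn m → ℂ} {z : Cn m} (hf : DifferentiableAt ℝ f z)
    (hg : DifferentiableAt ℝ g z) (k : Fin m) :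
    dbar (fun x => f x + g x) k z = dbar f k z + dbar g k z := by
  simp only [dbar, fderiv_fun_add hf hg, add_apply]
  ring

theorem dbar_sub {f g : Cn m → ℂ} {z : Cn m} (hf : DifferentiableAt ℝ f z)
    (hg : DifferentiableAt ℝ g z) (k : Fin m) :
    dbar (fun x => f x - g x) k z = dbar f k z - dbar g k z := by
  simp only [dbar, fderiv_fun_sub hf hg, sub_apply]
  ring

theorem dbar_dbar {f : Cn m → ℂ} (hf : ContDiff ℝ ∞ f) (j k : Fin m) (z : Cn m) :
    dbar (dbar f k) j z = dbar (dbar f j) k z := by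
  have hf2 : ContDiffAt ℝ 2 f z := hf.contDiffAt.of_le two_le_infty
  have hd : ∀ w, DifferentiableAt ℝ (fun x => fderiv ℝ f x w) z := fun w =>
    (differentiableAt_fderiv hf2).clm_apply (differentiableAt_const w)
  have h : ∀ k w, fderiv ℝ (dbar f k) z w = fderiv ℝ (fderiv ℝ f) z w (coordVec k) +
      Complex.I * fderiv ℝ (fderiv ℝ f) z w (Complex.I • coordVec k) := by
    intro k w
    have e : dbar f k = fun x => fderiv ℝ f x (coordVec k) +
      Complex.I * fderiv ℝ f x (Complex.I • coordVec k) := rfl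
    rw [e, fderiv_fun_add (hd _) ((hd _).const_mul _), fderiv_const_mul (hd _)]
    simp [fderiv_fderiv_apply hf2]
  have hs := hf2.isSymmSndFDerivAt (by simp)
  simp only [dbar, h]
  rw [hs.eq (coordVec j), hs.eq (coordVec j), hs.eq (Complex.I • coordVec j),
    hs.eq (Complex.I • coordVec j)]
  ring

/-- Solving the `∂̄`-equation in a single variable, by a cut-off Cauchy transform. -/
theorem exists_dbar_eq_single (k : Fin m) {b : Cn m → ℂ} (hb : ContDiff ℝ ∞ b) {R : ℝ}
    (hR : 0 < R) :
    ∃ f : Cn m → ℂ, ContDiff ℝ ∞ f ∧ (∀ᶠ z in 𝓝 0, dbar f k z = b z) ∧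
      ∀ j, j ≠ k → (∀ z ∈ Metric.ball (0 : Cn m) R, dbar b j z = 0) →
        ∀ᶠ z in 𝓝 0, dbar f j z = 0 := by
  let ψ : ContDiffBump (0 : ℂ) := ⟨R / 4, R / 2, by positivity, by linarith⟩
  have hψ0 : ∀ ζ : ℂ, R / 2 ≤ ‖ζ‖ → ψ ζ = 0 := fun ζ hζ =>
    ψ.zero_of_le_dist (by rw [dist_zero_right]; exact hζ)
  -- The cutoff depends on `x k` alone, so the derivatives `dbar _ j` with `j ≠ k` do not see it.
  set χ : Cn m → ℂ := fun x => (ψ (x k) : ℂ) with hχ_def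
  have hχ : ContDiff ℝ ∞ χ :=
    Complex.ofRealCLM.contDiff.comp (ψ.contDiff.comp (contDiff_coord k))
  set G : Cn m → ℂ := fun x => χ x * b x with hG_def
  have hG : ContDiff ℝ ∞ G := hχ.mul hb
  set F : Cn m → ℂ → ℂ := fun z ζ => G (z - ζ • coordVec k) with hF_def
  have hF : ContDiff ℝ ∞ (Function.uncurry F) :=
    hG.comp (contDiff_fst.sub (contDiff_snd.smul contDiff_const))
  have hG0 : ∀ x : Cn m, R / 2 ≤ ‖x k‖ → G x = 0 := fun x hx => by
    simp [hG_def, hχ_def, hψ0 _ hx]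
  have hcoord : ∀ (z : Cn m) (ζ : ℂ), (z - ζ • coordVec k) k = z k - ζ := by
    intro z ζ; simp
  have hF0 : ∀ (z : Cn m) (ζ : ℂ), ζ ∉ Metric.closedBall (0 : ℂ) (R / 2 + ‖z‖) → F z ζ = 0 := by
    intro z ζ hζ
    rw [mem_closedBall_zero_iff, not_le] at hζ
    refine hG0 _ ?_
    rw [hcoord]
    have h1 := norm_sub_norm_le ζ (z k)
    rw [norm_sub_rev] at h1
    linarith [PiLp.norm_apply_le z k]
  have hs : ∀ p₀ : Cn m, ∃ s : Set (Cn m), IsOpen s ∧ p₀ ∈ s ∧ ∃ K : Set ℂ, IsCompact K ∧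
      ∀ p ∈ s, ∀ x ∉ K, F p x = 0 := by
    intro p₀
    refine ⟨Metric.ball 0 (‖p₀‖ + 1), Metric.isOpen_ball, by simp,
      Metric.closedBall 0 (R / 2 + (‖p₀‖ + 1)), isCompact_closedBall _ _, fun p hp x hx => ?_⟩
    refine hF0 p x fun h => hx (Metric.closedBall_subset_closedBall ?_ h)
    have := mem_ball_zero_iff.1 hp
    linarith
  have hκ : LocallyIntegrable (fun ζ : ℂ => (2 * Real.pi : ℂ)⁻¹ * ζ⁻¹) :=
    locallyIntegrable_inv.smul ((2 * Real.pi : ℂ)⁻¹)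
  have hFd : ∀ (z w : Cn m) (ζ : ℂ),
      fderiv ℝ (fun q => F q ζ) z w = fderiv ℝ G (z - ζ • coordVec k) w := by
    intro z w ζ
    simp only [hF_def]
    rw [fderiv_comp_sub]
  -- The constant is `1/(2π)` instead of `1/π` because `dbar` is twice `∂/∂z̄`.
  set f : Cn m → ℂ := fun z => ∫ ζ : ℂ, ((2 * Real.pi : ℂ)⁻¹ * ζ⁻¹) * F z ζ with hf_def
  have hGd : Continuous (fderiv ℝ G) := hG.continuous_fderiv (by simp)
  have hint : ∀ z w : Cn m, Integrable fun ζ : ℂ => ((2 * Real.pi : ℂ)⁻¹ * ζ⁻¹) *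
      fderiv ℝ G (z - ζ • coordVec k) w := by
    intro z w
    refine hκ.integrable_smul_right_of_hasCompactSupport
      (g := fun ζ => fderiv ℝ G (z - ζ • coordVec k) w) ?_ ?_
    · exact (hGd.comp (by fun_prop)).clm_apply continuous_const
    · refine HasCompactSupport.intro (isCompact_closedBall (0 : ℂ) (R / 2 + ‖z‖)) fun ζ hζ => ?_
      rw [mem_closedBall_zero_iff, not_le] at hζ
      have h2 : R / 2 < ‖(z - ζ • coordVec k) k‖ := by
        rw [hcoord]
        have h1 := norm_sub_norm_le ζ (z k)
        rw [norm_sub_rev] at h1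
        linarith [PiLp.norm_apply_le z k]
      have h3 : G =ᶠ[𝓝 (z - ζ • coordVec k)] fun _ => 0 := by
        filter_upwards [(isOpen_lt continuous_const
          (contDiff_coord (n := 0) k).continuous.norm).mem_nhds h2] with x hx
        exact hG0 x (le_of_lt hx)
      rw [h3.fderiv_eq]
      simp
  have hdf : ∀ (j : Fin m) (z : Cn m), dbar f j z =
      ∫ ζ : ℂ, ((2 * Real.pi : ℂ)⁻¹ * ζ⁻¹) * dbar G j (z - ζ • coordVec k) := by
    intro j z
    rw [dbar, fderiv_integral_mul hκ hF hs, fderiv_integral_mul hκ hF hs,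
      ← integral_const_mul]
    simp only [hFd]
    rw [← integral_add (hint _ _) ((hint _ _).const_mul _)]
    refine integral_congr_ae (Filter.Eventually.of_forall fun ζ => ?_)
    simp only [dbar]
    ring
  refine ⟨f, contDiff_integral_mul hκ hF hs, ?_, fun j hj hbj => ?_⟩
  · filter_upwards [Metric.ball_mem_nhds (0 : Cn m) (by positivity : 0 < R / 4)] with z hz
    have hz' := mem_ball_zero_iff.1 hz
    set h : ℂ → ℂ := fun ζ => G (z - ζ • coordVec k) with hh_def
    have hh : ContDiff ℝ ∞ h :=
      hG.comp (contDiff_const.sub (contDiff_id.smul contDiff_const))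
    have hhc : HasCompactSupport h :=
      HasCompactSupport.intro (isCompact_closedBall (0 : ℂ) (R / 2 + ‖z‖)) fun ζ hζ => hF0 z ζ hζ
    have hhd : ∀ ζ w : ℂ, fderiv ℝ h ζ w = -fderiv ℝ G (z - ζ • coordVec k) (w • coordVec k) := by
      intro ζ w
      have h1 : HasFDerivAt (fun ζ : ℂ => z - ζ • coordVec k)
          (-((ContinuousLinearMap.toSpanSingleton ℂ (coordVec k)).restrictScalars ℝ)) ζ :=
        (((ContinuousLinearMap.toSpanSingleton ℂ (coordVec k)).restrictScalars ℝ).hasFDerivAt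
          (x := ζ)).const_sub z
      have h2 := ((hG.differentiable (by simp) (z - ζ • coordVec k)).hasFDerivAt).comp ζ h1
      have h3 : HasFDerivAt h _ ζ := h2
      rw [h3.fderiv]
      simp
    have hCP := integral_inv_mul_dbar (hh.of_le (by exact_mod_cast le_top)) hhc
    have hpi : (2 * Real.pi : ℂ) ≠ 0 := by
      simp [Real.pi_ne_zero]
    calc dbar f k z = ∫ ζ : ℂ, (-(2 * Real.pi : ℂ)⁻¹) * (ζ⁻¹ * (fderiv ℝ h ζ 1 +
          Complex.I * fderiv ℝ h ζ Complex.I)) := by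
          rw [hdf]
          refine integral_congr_ae (Filter.Eventually.of_forall fun ζ => ?_)
          simp only [dbar, hhd, one_smul]
          ring
      _ = h 0 := by
          rw [integral_const_mul, hCP]
          field_simp
      _ = b z := by
          have h4 : ψ (z k) = 1 := ψ.one_of_mem_closedBall (by
            rw [mem_closedBall_zero_iff]
            exact (PiLp.norm_apply_le z k).trans hz'.le)
          simp [hh_def, hG_def, hχ_def, h4]
  -- Where the cutoff is nonzero, the shifted point has norm at most `2 ‖z‖ + R/2 < R`, so `dbar b
  -- j` vanishes there.
  · filter_upwards [Metric.ball_mem_nhds (0 : Cn m) (by positivity : 0 < R / 8)] with z hz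
    have hz' := mem_ball_zero_iff.1 hz
    have hGj : ∀ x : Cn m, dbar G j x = χ x * dbar b j x := by
      intro x
      have hχd : ∀ c : ℂ, fderiv ℝ χ x (c • coordVec j) = 0 := by
        intro c
        have h1 : HasFDerivAt (fun y : ℂ => (ψ y : ℂ))
            (fderiv ℝ (fun y : ℂ => (ψ y : ℂ)) (x k)) (x k) :=
          ((Complex.ofRealCLM.contDiff.comp (ψ.contDiff (n := 1))).differentiable
            one_ne_zero _).hasFDerivAt
        have h2 : HasFDerivAt χ _ x := h1.comp x (hasFDerivAt_coord k x)
        rw [h2.fderiv]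
        simp [coordVec_of_ne hj]
      have hχd1 : fderiv ℝ χ x (coordVec j) = 0 := by simpa using hχd 1
      simp only [dbar, hG_def]
      rw [fderiv_fun_mul (hχ.differentiable (by simp) x) (hb.differentiable (by simp) x)]
      simp only [add_apply, smul_apply, hχd, hχd1]
      simp
      ring
    rw [hdf]
    refine integral_eq_zero_of_ae (Filter.Eventually.of_forall fun ζ => ?_)
    simp only [hGj, Pi.zero_apply]
    rcases le_or_gt (R / 2) ‖z k - ζ‖ with h | h
    · have : χ (z - ζ • coordVec k) = 0 := by
        simp only [hχ_def, hcoord, hψ0 _ h, Complex.ofReal_zero]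
      rw [this]; simp
    · rw [hbj]
      · simp
      rw [mem_ball_zero_iff]
      have e : z - ζ • coordVec k = (z - z k • coordVec k) + (z k - ζ) • coordVec k := by
        rw [sub_smul]; abel
      have h5 : ‖z - z k • coordVec k‖ ≤ ‖z‖ + ‖z k‖ := by
        refine (norm_sub_le _ _).trans ?_
        rw [norm_smul, norm_coordVec, mul_one]
      have h6 : ‖(z k - ζ) • coordVec k‖ = ‖z k - ζ‖ := by
        rw [norm_smul, norm_coordVec, mul_one]
      rw [e]
      linarith [norm_add_le (z - z k • coordVec k) ((z k - ζ) • coordVec k),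
        PiLp.norm_apply_le z k]

/-- The Dolbeault-Grothendieck lemma for germs of `(0,1)`-forms. -/
theorem exists_dbar_eq {a : Fin m → Cn m → ℂ} (ha : ∀ k, ContDiff ℝ ∞ (a k))
    (hclosed : ∀ᶠ z in 𝓝 0, ∀ j k, dbar (a k) j z = dbar (a j) k z) :
    ∃ f : Cn m → ℂ, ContDiff ℝ ∞ f ∧ ∀ᶠ z in 𝓝 0, ∀ k, dbar f k z = a k z := by
  -- Induction on a set `S` of indices outside which the components of the form vanish near `0`.
  suffices H : ∀ (S : Finset (Fin m)) (a : Fin m → Cn m → ℂ), (∀ k, ContDiff ℝ ∞ (a k)) →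
      (∀ᶠ z in 𝓝 0, ∀ j k, dbar (a k) j z = dbar (a j) k z) →
      (∀ᶠ z in 𝓝 0, ∀ k ∉ S, a k z = 0) →
      ∃ f : Cn m → ℂ, ContDiff ℝ ∞ f ∧ ∀ᶠ z in 𝓝 0, ∀ k, dbar f k z = a k z from
    H Finset.univ a ha hclosed (by simp)
  intro S
  induction S using Finset.induction_on with
  | empty =>
    intro a _ _ h0
    refine ⟨fun _ => 0, contDiff_const, ?_⟩
    filter_upwards [h0] with z hz k
    simp [dbar, hz k]
  | insert i S hi ih =>
    intro a ha hcl h0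
    -- Closedness makes `a i` holomorphic in the variables whose components vanish. Solving in the
    -- variable `i` therefore removes the component `i` without reviving those.
    have h0' : ∀ᶠ z in 𝓝 0, ∀ j ∉ insert i S, dbar (a i) j z = 0 := by
      filter_upwards [hcl, h0.eventually_nhds] with z hz hz0 j hj
      rw [hz]
      have : a j =ᶠ[𝓝 z] fun _ => 0 := hz0.mono fun x hx => hx j hj
      simp [dbar, this.fderiv_eq]
    obtain ⟨R, hR, hball⟩ := Metric.eventually_nhds_iff_ball.1 h0'
    obtain ⟨g, hg, hgi, hgj⟩ := exists_dbar_eq_single i (ha i) hR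
    have hgd : ∀ k z, DifferentiableAt ℝ (dbar g k) z := fun k z =>
      (contDiff_dbar hg k).differentiable (by simp) z
    have had : ∀ k z, DifferentiableAt ℝ (a k) z := fun k z =>
      (ha k).differentiable (by simp) z
    have hgj' : ∀ᶠ z in 𝓝 0, ∀ j ∉ insert i S, dbar g j z = 0 := by
      rw [Filter.eventually_all]
      intro j
      by_cases hj : j ∈ insert i S
      · exact Filter.Eventually.of_forall fun z hz => absurd hj hz
      · refine (hgj j ?_ fun z hz => hball z hz j hj).mono fun z hz _ => hz
        rintro rfl
        exact hj (Finset.mem_insert_self _ _)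
    obtain ⟨f, hf, hfa⟩ := ih (fun k z => a k z - dbar g k z)
      (fun k => (ha k).sub (contDiff_dbar hg k)) (by
        filter_upwards [hcl] with z hz j k
        rw [dbar_sub (had k z) (hgd k z), dbar_sub (had j z) (hgd j z), hz, dbar_dbar hg]) (by
        filter_upwards [h0, hgi, hgj'] with z hz hzi hzj k hk
        by_cases hki : k = i
        · rw [hki, hzi, sub_self]
        · have : k ∉ insert i S := by simp [hki, hk]
          rw [hz k this, hzj k this, sub_self])
    refine ⟨fun z => f z + g z, hf.add hg, ?_⟩
    filter_upwards [hfa] with z hz k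
    rw [dbar_add (hf.differentiable (by simp) z) (hg.differentiable (by simp) z), hz]
    ring

end KahlerCone

namespace KahlerCone

open MeasureTheory

/-! ### The Poincaré lemma for `2`-forms -/

section Poincare

variable {E : Type*} [NormedAddCommGroup E] [NormedSpace ℝ E]

/-- A `2`-form as a bilinear form. -/
noncomputable def bilinOfForm (E : Type*) [NormedAddCommGroup E] [NormedSpace ℝ E] :
    (E [⋀^Fin 2]→L[ℝ] ℝ) →L[ℝ] E →L[ℝ] E →L[ℝ] ℝ :=
  (ContinuousLinearMap.compL ℝ E (E [⋀^Fin 1]→L[ℝ] ℝ) (E →L[ℝ] ℝ)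
    (ContinuousAlternatingMap.ofSubsingletonLIE (𝕜 := ℝ) (E := E) (F := ℝ)
      (0 : Fin 1)).symm.toContinuousLinearEquiv.toContinuousLinearMap).comp
    (ContinuousAlternatingMap.curryLeftLI (𝕜 := ℝ) (E := E) (F := ℝ)
      (n := 1)).toContinuousLinearMap

theorem bilinOfForm_apply (θ : E [⋀^Fin 2]→L[ℝ] ℝ) (v w : E) :
    bilinOfForm E θ v w = θ ![v, w] := by
  change θ (Matrix.vecCons v fun _ => w) = _
  congr 1
  ext i
  fin_cases i <;> rfl

theorem contDiff_bilinOfForm_comp {f : E → E [⋀^Fin 2]→L[ℝ] ℝ} (hf : ContDiff ℝ ∞ f) :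
    ContDiff ℝ ∞ fun z => bilinOfForm E (f z) := by
  have h := ContinuousLinearMap.contDiff (𝕜 := ℝ) (E := E [⋀^Fin 2]→L[ℝ] ℝ)
    (F := E →L[ℝ] E →L[ℝ] ℝ) (n := ∞) (bilinOfForm E)
  exact h.comp hf

theorem fderiv_bilinOfForm_comp {f : E → E [⋀^Fin 2]→L[ℝ] ℝ} {z : E}
    (hf : DifferentiableAt ℝ f z) (u v w : E) :
    fderiv ℝ (fun z => bilinOfForm E (f z)) z u v w = fderiv ℝ f z u ![v, w] := by
  have h : HasFDerivAt (fun z => bilinOfForm E (f z)) ((bilinOfForm E).comp (fderiv ℝ f z)) z := by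
    refine HasFDerivAt.comp (𝕜 := ℝ) (E := E) (F := E [⋀^Fin 2]→L[ℝ] ℝ)
      (G := E →L[ℝ] E →L[ℝ] ℝ) (g := bilinOfForm E) (g' := bilinOfForm E) z ?_ hf.hasFDerivAt
    exact ContinuousLinearMap.hasFDerivAt (𝕜 := ℝ) (E := E [⋀^Fin 2]→L[ℝ] ℝ)
      (F := E →L[ℝ] E →L[ℝ] ℝ) (bilinOfForm E)
  rw [h.fderiv]
  exact bilinOfForm_apply _ _ _

theorem integral_indicator_Icc_mul (g : ℝ → ℝ) :
    ∫ t, (Set.Icc (0 : ℝ) 1).indicator (fun _ => (1 : ℝ)) t * g t = ∫ t in (0 : ℝ)..1, g t := by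
  have h : (fun t => (Set.Icc (0 : ℝ) 1).indicator (fun _ => (1 : ℝ)) t * g t) =
      (Set.Icc (0 : ℝ) 1).indicator g := by
    ext t
    by_cases ht : t ∈ Set.Icc (0 : ℝ) 1 <;> simp [ht]
  rw [h, integral_indicator measurableSet_Icc, integral_Icc_eq_integral_Ioc,
    intervalIntegral.integral_of_le zero_le_one]

/-- The Poincaré lemma for `2`-forms on a ball, by integration along rays. -/
theorem exists_primitive_of_closed {B : E → E →L[ℝ] E →L[ℝ] ℝ} (hB : ContDiff ℝ ∞ B)
    (hasym : ∀ z v w, B z v w = -B z w v) {R : ℝ}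
    (hclosed : ∀ z ∈ Metric.ball (0 : E) R, ∀ u v w,
      fderiv ℝ B z u v w - fderiv ℝ B z v u w + fderiv ℝ B z w u v = 0) :
    ∃ β : E → E →ₗ[ℝ] ℝ, (∀ v, ContDiff ℝ ∞ fun z => β z v) ∧
      ∀ z ∈ Metric.ball (0 : E) R, ∀ v w,
        fderiv ℝ (fun x => β x w) z v - fderiv ℝ (fun x => β x v) z w = B z v w := by
  -- Equal to `1` on `[0,1]`, so it does not change the integral along the ray; it only makes the
  -- integrand compactly supported in `t`.
  let ψ : ContDiffBump (0 : ℝ) := ⟨1, 2, one_pos, one_lt_two⟩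
  have hψ1 : ∀ t ∈ Set.uIcc (0 : ℝ) 1, ψ t = 1 := fun t ht => by
    rw [Set.uIcc_of_le zero_le_one] at ht
    refine ψ.one_of_mem_closedBall ?_
    rw [mem_closedBall_zero_iff, Real.norm_of_nonneg ht.1]
    exact ht.2
  set f : ℝ → ℝ := (Set.Icc (0 : ℝ) 1).indicator fun _ => (1 : ℝ)
  have hf : LocallyIntegrable f :=
    (((integrableOn_const (by simp)).integrable_indicator measurableSet_Icc)).locallyIntegrable
  have hBt : ∀ v, ContDiff ℝ ∞ fun q : E × ℝ => B (q.2 • q.1) q.1 v := fun v =>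
    ((hB.comp (contDiff_snd.smul contDiff_fst)).clm_apply contDiff_fst).clm_apply contDiff_const
  set F : E → E → ℝ → ℝ := fun v z t => ψ t * (t * B (t • z) z v) with hF_def
  have hF : ∀ v, ContDiff ℝ ∞ (Function.uncurry (F v)) := fun v =>
    (ψ.contDiff.comp contDiff_snd).mul (contDiff_snd.mul (hBt v))
  have hs : ∀ v, ∀ p₀ : E, ∃ s : Set E, IsOpen s ∧ p₀ ∈ s ∧ ∃ k : Set ℝ, IsCompact k ∧
      ∀ p ∈ s, ∀ x ∉ k, F v p x = 0 := fun v p₀ =>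
    ⟨Set.univ, isOpen_univ, Set.mem_univ _, Metric.closedBall 0 2, isCompact_closedBall _ _,
      fun p _ x hx => by
        have : ψ x = 0 := ψ.zero_of_le_dist (le_of_lt (by simpa using hx))
        simp [hF_def, this]⟩
  have hFc : ∀ v z, Continuous (F v z) := fun v z => 
    (hF v).continuous.comp (Continuous.prodMk_right z)
  have hFi : ∀ v z, IntervalIntegrable (F v z) volume 0 1 := fun v z =>
    (hFc v z).intervalIntegrable 0 1
  have hβ : ∀ v z, ∫ t, f t * F v z t = ∫ t in (0 : ℝ)..1, F v z t := fun v z =>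
    integral_indicator_Icc_mul _
  have hlin : ∀ z, IsLinearMap ℝ fun v => ∫ t, f t * F v z t := by
    refine fun z => ⟨fun v w => ?_, fun c v => ?_⟩
    · rw [hβ, hβ, hβ, ← intervalIntegral.integral_add (hFi v z) (hFi w z)]
      congr 1
      ext t
      simp only [hF_def, map_add]
      ring
    · rw [hβ, hβ, smul_eq_mul, ← intervalIntegral.integral_const_mul]
      congr 1
      ext t
      simp only [hF_def, map_smul, smul_eq_mul]
      ring
  refine ⟨fun z => IsLinearMap.mk' _ (hlin z), fun v => contDiff_integral_mul hf (hF v) (hs v),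
    fun z hz v w => ?_⟩
  have hd : ∀ (t : ℝ) (a b : E), fderiv ℝ (fun q => F b q t) z a =
      ψ t * (t * (t * fderiv ℝ B (t • z) a z b + B (t • z) a b)) := by
    intro t a b
    have h1 : HasFDerivAt (fun q : E => t • q) (t • ContinuousLinearMap.id ℝ E) z :=
      (hasFDerivAt_id z).const_smul t
    have h2 : HasFDerivAt (fun q : E => B (t • q))
        ((fderiv ℝ B (t • z)).comp (t • ContinuousLinearMap.id ℝ E)) z :=
      (hB.differentiable (by simp) (t • z)).hasFDerivAt.comp z h1
    have h3 := (h2.clm_apply (hasFDerivAt_id z)).clm_apply (hasFDerivAt_const b z)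
    have h4 : HasFDerivAt (fun q => F b q t) _ z := (h3.const_mul t).const_mul (ψ t)
    rw [h4.fderiv]
    simp
    ring
  have hcont : ∀ a b : E, IntervalIntegrable (fun t => fderiv ℝ (fun q => F b q t) z a)
      volume 0 1 := by
    intro a b
    simp only [hd]
    refine Continuous.intervalIntegrable ?_ 0 1
    have h5 : Continuous fun t : ℝ => t • z := by fun_prop
    exact ψ.continuous.mul (continuous_id.mul ((continuous_id.mul
      (((((hB.continuous_fderiv (by simp)).comp h5).clm_apply
        continuous_const).clm_apply continuous_const).clm_apply continuous_const)).add
      (((hB.continuous.comp h5).clm_apply continuous_const).clm_apply continuous_const)))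
  -- By closedness the integrand of `dβ(v,w)` is this total derivative, whose integral over `[0,1]`
  -- is `B z v w`.
  have hder : ∀ t : ℝ, HasDerivAt (fun t : ℝ => t ^ 2 * B (t • z) v w)
      (2 * t * B (t • z) v w + t ^ 2 * fderiv ℝ B (t • z) z v w) t := by
    intro t
    have h1 : HasDerivAt (fun t : ℝ => t • z) z t := by
      simpa using (hasDerivAt_id t).smul_const z
    have h2 : HasDerivAt (fun t : ℝ => B (t • z)) (fderiv ℝ B (t • z) z) t :=
      HasFDerivAt.comp_hasDerivAt (f := fun t : ℝ => t • z) t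
        (hB.differentiable (by simp) (t • z)).hasFDerivAt h1
    have h3 := (h2.clm_apply (hasDerivAt_const t v)).clm_apply (hasDerivAt_const t w)
    have h4 := (hasDerivAt_pow 2 t).mul h3
    refine h4.congr_deriv ?_
    simp
  have e : ∀ b, (fun x => IsLinearMap.mk' _ (hlin x) b) = fun x => ∫ t, f t * F b x t := fun b => rfl
  rw [e, e, fderiv_integral_mul hf (hF w) (hs w), fderiv_integral_mul hf (hF v) (hs v),
    integral_indicator_Icc_mul, integral_indicator_Icc_mul,
    ← intervalIntegral.integral_sub (hcont v w) (hcont w v)]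
  have hint : ∫ t in (0 : ℝ)..1, (2 * t * B (t • z) v w + t ^ 2 * fderiv ℝ B (t • z) z v w) =
      B z v w := by
    rw [intervalIntegral.integral_eq_sub_of_hasDerivAt (fun t _ => hder t)]
    · simp
    refine Continuous.intervalIntegrable ?_ 0 1
    have h5 : Continuous fun t : ℝ => t • z := by fun_prop
    exact ((continuous_const.mul continuous_id).mul
      (((hB.continuous.comp h5).clm_apply continuous_const).clm_apply continuous_const)).add
      ((continuous_id.pow 2).mul
      (((((hB.continuous_fderiv (by simp)).comp h5).clm_apply
        continuous_const).clm_apply continuous_const).clm_apply continuous_const))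
  rw [← hint]
  refine intervalIntegral.integral_congr fun t ht => ?_
  have hψt := hψ1 t ht
  rw [Set.uIcc_of_le zero_le_one] at ht
  have htz : t • z ∈ Metric.ball (0 : E) R := by
    rw [mem_ball_zero_iff] at hz ⊢
    rw [norm_smul, Real.norm_of_nonneg ht.1]
    exact (mul_le_of_le_one_left (norm_nonneg z) ht.2).trans_lt hz
  have h6 := hclosed _ htz z v w
  simp only [hd, hψt]
  rw [hasym (t • z) w v]
  linear_combination (-t ^ 2) * h6

end Poincare

end KahlerCone

namespace KahlerCone

variable {m : ℕ}

/-! ### Local Kähler potentials -/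

theorem form_ext {θ₁ θ₂ : Cn m [⋀^Fin 2]→L[ℝ] ℝ} (h : ∀ v w, θ₁ ![v, w] = θ₂ ![v, w]) :
    θ₁ = θ₂ := by
  ext u
  have : u = ![u 0, u 1] := by
    ext i
    fin_cases i <;> rfl
  rw [this]
  exact h _ _

theorem form_swap (θ : Cn m [⋀^Fin 2]→L[ℝ] ℝ) (v w : Cn m) : θ ![v, w] = -θ ![w, v] := by
  have h := θ.map_add_swap ![w, v] (i := 0) (j := 1) (by simp)
  have e : ![w, v] ∘ Equiv.swap (0 : Fin 2) 1 = ![v, w] := by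
    ext i
    fin_cases i <;> simp
  rw [e] at h
  have h' : θ ![w, v] + θ ![v, w] = 0 := h
  linarith

/-- Lets local data be replaced by global data with the same germ, so that the integral formulas
apply on the whole space. -/
theorem contDiff_smul_of_contDiffOn {F : Type*} [NormedAddCommGroup F] [NormedSpace ℝ F]
    {f : Cn m → F} {U : Set (Cn m)} (hU : IsOpen U) (hf : ContDiffOn ℝ ∞ f U)
    {φ : Cn m → ℝ} (hφ : ContDiff ℝ ∞ φ) (hφU : tsupport φ ⊆ U) :
    ContDiff ℝ ∞ fun z => φ z • f z := by
  rw [contDiff_iff_contDiffAt]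
  intro z
  by_cases hz : z ∈ U
  · exact hφ.contDiffAt.smul (hf.contDiffAt (hU.mem_nhds hz))
  · have : (fun z => φ z • f z) =ᶠ[𝓝 z] fun _ => 0 := by
      filter_upwards [(isClosed_tsupport φ).isOpen_compl.mem_nhds fun h => hz (hφU h)] with x hx
      rw [image_eq_zero_of_notMem_tsupport hx, zero_smul]
    exact contDiffAt_const.congr_of_eventuallyEq this

theorem sum_coordVec (v : Cn m) :
    v = ∑ k, ((v k).re • coordVec k + (v k).im • (Complex.I • coordVec k)) := by
  ext i
  simp only [WithLp.ofLp_sum, Finset.sum_apply, PiLp.add_apply, PiLp.smul_apply]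
  rw [Finset.sum_eq_single i]
  · simp [Complex.re_add_im]
  · intro k _ hk
    simp [coordVec_of_ne hk]
  · simp

theorem linearMap_ext_coordVec {f g : Cn m →ₗ[ℝ] ℝ} (h1 : ∀ k, f (coordVec k) = g (coordVec k))
    (h2 : ∀ k, f (Complex.I • coordVec k) = g (Complex.I • coordVec k)) : f = g := by
  ext v
  rw [sum_coordVec v]
  simp only [map_sum, map_add, map_smul, h1, h2]

/-- The local `∂∂̄`-lemma: a closed real `(1,1)`-form has a potential near `0`. -/
theorem exists_local_potential {θ : Cn m → Cn m [⋀^Fin 2]→L[ℝ] ℝ} {U : Set (Cn m)}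
    (hU : IsOpen U) (hU0 : (0 : Cn m) ∈ U) (hθ : ContDiffOn ℝ ∞ θ U)
    (hclosed : ∀ z ∈ U, extDeriv θ z = 0)
    (hinv : ∀ z ∈ U, ∀ v w, θ z ![J m v, J m w] = θ z ![v, w]) :
    ∃ h : Cn m → ℝ, ContDiff ℝ ∞ h ∧ ∀ᶠ z in 𝓝 0, ddc h z = θ z := by
  obtain ⟨r, hr, hrU⟩ := Metric.nhds_basis_closedBall.mem_iff.1 (hU.mem_nhds hU0)
  let φ : ContDiffBump (0 : Cn m) := ⟨r / 2, r, by positivity, by linarith⟩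
  set η : Cn m → Cn m [⋀^Fin 2]→L[ℝ] ℝ := fun z => φ z • θ z with hη_def
  have hη : ContDiff ℝ ∞ η := contDiff_smul_of_contDiffOn hU hθ φ.contDiff
    (by rw [φ.tsupport_eq]; exact hrU)
  have hηθ : ∀ z ∈ Metric.ball (0 : Cn m) (r / 2), η z = θ z := fun z hz => by
    simp [hη_def, φ.one_of_mem_closedBall (Metric.ball_subset_closedBall hz)]
  have hballU : Metric.ball (0 : Cn m) (r / 2) ⊆ U := fun z hz => hrU
    (Metric.closedBall_subset_closedBall (by linarith) (Metric.ball_subset_closedBall hz))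
  set B : Cn m → Cn m →L[ℝ] Cn m →L[ℝ] ℝ := fun z => bilinOfForm (Cn m) (η z) with hB_def
  have hB : ContDiff ℝ ∞ B := contDiff_bilinOfForm_comp hη
  have hBapp : ∀ z v w, B z v w = η z ![v, w] := fun z v w => bilinOfForm_apply _ _ _
  have hdB : ∀ z u v w, fderiv ℝ B z u v w = fderiv ℝ η z u ![v, w] := fun z =>
    fderiv_bilinOfForm_comp (hη.differentiable (by simp) z)
  obtain ⟨β, hβ, hdβ⟩ := exists_primitive_of_closed hB
    (fun z v w => by rw [hBapp, hBapp, form_swap]) (R := r / 2) (by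
      intro z hz u v w
      have h1 : extDeriv η z = 0 := by
        rw [Filter.EventuallyEq.extDeriv_eq (ω₂ := θ), hclosed z (hballU hz)]
        filter_upwards [Metric.isOpen_ball.mem_nhds hz] with x hx
        exact hηθ x hx
      have h2 := congrArg (fun α : Cn m [⋀^Fin 3]→L[ℝ] ℝ => α ![u, v, w]) h1
      simp only [extDeriv, ContinuousAlternatingMap.alternatizeUncurryFin_apply] at h2
      rw [Fin.sum_univ_three] at h2
      have e0 : (0 : Fin 3).removeNth ![u, v, w] = ![v, w] := by
        ext i; fin_cases i <;> rfl
      have e1 : (1 : Fin 3).removeNth ![u, v, w] = ![u, w] := by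
        ext i; fin_cases i <;> rfl
      have e2 : (2 : Fin 3).removeNth ![u, v, w] = ![u, v] := by
        ext i; fin_cases i <;> rfl
      rw [e0, e1, e2] at h2
      simp only [hdB]
      simp at h2
      linarith)
  -- Twice the components of the (0,1)-part of the primitive `β`, in the normalization of `dbar`.
  set a : Fin m → Cn m → ℂ := fun k z =>
    (β z (coordVec k) : ℂ) + Complex.I * (β z (Complex.I • coordVec k) : ℂ) with ha_def
  have hβC : ∀ v, ContDiff ℝ ∞ fun z => (β z v : ℂ) := fun v =>
    Complex.ofRealCLM.contDiff.comp (hβ v)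
  have ha : ∀ k, ContDiff ℝ ∞ (a k) := fun k => (hβC _).add (contDiff_const.mul (hβC _))
  have hda : ∀ k z w, fderiv ℝ (a k) z w = (fderiv ℝ (fun x => β x (coordVec k)) z w : ℂ) +
      Complex.I * (fderiv ℝ (fun x => β x (Complex.I • coordVec k)) z w : ℂ) := by
    intro k z w
    have h1 : ∀ v, HasFDerivAt (fun x => (β x v : ℂ))
        (Complex.ofRealCLM.comp (fderiv ℝ (fun x => β x v) z)) z := fun v =>
      Complex.ofRealCLM.hasFDerivAt.comp z ((hβ v).differentiable (by simp) z).hasFDerivAt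
    have h2 : HasFDerivAt (a k) _ z := (h1 (coordVec k)).add
      ((h1 (Complex.I • coordVec k)).const_mul Complex.I)
    rw [h2.fderiv]
    simp
  have hball : Metric.ball (0 : Cn m) (r / 2) ∈ 𝓝 (0 : Cn m) :=
    Metric.ball_mem_nhds _ (by positivity)
  obtain ⟨f, hf, hfa⟩ := exists_dbar_eq ha (by
    filter_upwards [hball] with z hz j k
    have c1 := hdβ z hz (coordVec j) (coordVec k)
    have c2 := hdβ z hz (Complex.I • coordVec j) (Complex.I • coordVec k)
    have c3 := hdβ z hz (coordVec j) (Complex.I • coordVec k)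
    have c4 := hdβ z hz (Complex.I • coordVec j) (coordVec k)
    rw [hBapp, hηθ z hz] at c1 c2 c3 c4
    have i1 := hinv z (hballU hz) (coordVec j) (coordVec k)
    have i2 := hinv z (hballU hz) (coordVec j) (Complex.I • coordVec k)
    rw [J_apply, J_apply] at i1
    rw [← J_apply (coordVec k), J_J, J_apply, J_apply, ← bilinOfForm_apply, map_neg,
      bilinOfForm_apply] at i2
    -- Invariance under `J`, read on `dβ`, gives the real part `r1` and the imaginary part `r2` of
    -- `∂̄`-closedness.
    have r1 : fderiv ℝ (fun x => β x (coordVec k)) z (coordVec j) -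
        fderiv ℝ (fun x => β x (Complex.I • coordVec k)) z (Complex.I • coordVec j) =
        fderiv ℝ (fun x => β x (coordVec j)) z (coordVec k) -
        fderiv ℝ (fun x => β x (Complex.I • coordVec j)) z (Complex.I • coordVec k) := by
      linarith
    have r2 : fderiv ℝ (fun x => β x (Complex.I • coordVec k)) z (coordVec j) +
        fderiv ℝ (fun x => β x (coordVec k)) z (Complex.I • coordVec j) =
        fderiv ℝ (fun x => β x (Complex.I • coordVec j)) z (coordVec k) +
        fderiv ℝ (fun x => β x (coordVec j)) z (Complex.I • coordVec k) := by
      linarith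
    have r1' := congrArg Complex.ofReal r1
    have r2' := congrArg Complex.ofReal r2
    simp only [Complex.ofReal_sub, Complex.ofReal_add] at r1' r2'
    simp only [dbar, hda]
    linear_combination r1' + Complex.I * r2' +
      ((fderiv ℝ (fun x => β x (Complex.I • coordVec k)) z (Complex.I • coordVec j) : ℂ) -
      (fderiv ℝ (fun x => β x (Complex.I • coordVec j)) z (Complex.I • coordVec k) : ℂ)) *
        Complex.I_mul_I)
  set g : Cn m → ℝ := fun z => (f z).re
  set h : Cn m → ℝ := fun z => (f z).im
  have hg : ContDiff ℝ ∞ g := Complex.reCLM.contDiff.comp hf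
  have hh : ContDiff ℝ ∞ h := Complex.imCLM.contDiff.comp hf
  have hfd : ∀ z, HasFDerivAt f (fderiv ℝ f z) z := fun z =>
    (hf.differentiable (by simp) z).hasFDerivAt
  have hdg : ∀ z, fderiv ℝ g z = Complex.reCLM.comp (fderiv ℝ f z) := fun z =>
    (Complex.reCLM.hasFDerivAt.comp z (hfd z)).fderiv
  have hdh : ∀ z, fderiv ℝ h z = Complex.imCLM.comp (fderiv ℝ f z) := fun z =>
    (Complex.imCLM.hasFDerivAt.comp z (hfd z)).fderiv
  -- With `f = g + i h`, the equation `dbar f k = a k` says `β = dg - dh ∘ J = dg + d^c h`, whence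
  -- `dβ = dd^c h`.
  have hdecomp : ∀ᶠ z in 𝓝 0, ∀ v, fderiv ℝ h z (J m v) = fderiv ℝ g z v - β z v := by
    filter_upwards [hfa] with z hz
    have hlin : β z = (fderiv ℝ g z - (fderiv ℝ h z).comp (J m)).toLinearMap := by
      refine linearMap_ext_coordVec (fun k => ?_) fun k => ?_
      · have h1 := congrArg Complex.re (hz k)
        simp [dbar, ha_def] at h1
        simp [hdg, hdh]
        linarith
      · have h1 := congrArg Complex.im (hz k)
        simp [dbar, ha_def] at h1
        have h2 : Complex.I • Complex.I • coordVec k = -coordVec k := J_J (coordVec k)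
        simp only [ContinuousLinearMap.coe_coe, sub_apply,
          ContinuousLinearMap.comp_apply, J_apply, hdg, hdh, h2, map_neg, Complex.reCLM_apply,
          Complex.imCLM_apply]
        linarith
    intro v
    rw [hlin]
    simp
  refine ⟨h, hh, ?_⟩
  filter_upwards [hdecomp.eventually_nhds, hball] with z hz hzb
  have hh2 : ContDiffAt ℝ 2 h z := hh.contDiffAt.of_le two_le_infty
  have hg2 : ContDiffAt ℝ 2 g z := hg.contDiffAt.of_le two_le_infty
  have key : ∀ v w, fderiv ℝ (fderiv ℝ h) z w (J m v) =
      fderiv ℝ (fderiv ℝ g) z w v - fderiv ℝ (fun x => β x v) z w := by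
    intro v w
    have h1 : (fun x => fderiv ℝ h x (J m v)) =ᶠ[𝓝 z] fun x => fderiv ℝ g x v - β x v :=
      hz.mono fun x hx => hx v
    rw [← fderiv_fderiv_apply hh2, h1.fderiv_eq, fderiv_fun_sub
      (differentiableAt_fderiv_apply hg2 v) ((hβ v).differentiable (by simp) z),
      sub_apply, fderiv_fderiv_apply hg2]
  refine form_ext fun v w => ?_
  rw [ddc_apply hh2, key, key, (hg2.isSymmSndFDerivAt (by simp)).eq w v, ← hηθ z hzb, ← hBapp,
    ← hdβ z hzb v w]
  ring

/-! ### Normalized potentials and the gluing of Kähler forms. -/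

theorem IsKahlerFormOn.of_locally {θ : Cn m → Cn m [⋀^Fin 2]→L[ℝ] ℝ} {Y : Set (Cn m)}
    (h : ∀ z ∈ Y, ∃ N : Set (Cn m), IsOpen N ∧ z ∈ N ∧ ∃ θ₁, IsKahlerFormOn θ₁ N ∧
      Set.EqOn θ θ₁ N) : IsKahlerFormOn θ Y where
  smooth z hz := by
    obtain ⟨N, hN, hzN, θ₁, hθ₁, heq⟩ := h z hz
    exact ((hθ₁.smooth.contDiffAt (hN.mem_nhds hzN)).congr_of_eventuallyEq
      (heq.eventuallyEq_of_mem (hN.mem_nhds hzN))).contDiffWithinAt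
  closed z hz := by
    obtain ⟨N, hN, hzN, θ₁, hθ₁, heq⟩ := h z hz
    rw [(heq.eventuallyEq_of_mem (hN.mem_nhds hzN)).extDeriv_eq, hθ₁.closed z hzN]
  invariant z hz := by
    obtain ⟨N, hN, hzN, θ₁, hθ₁, heq⟩ := h z hz
    rw [heq hzN]
    exact hθ₁.invariant z hzN
  pos z hz := by
    obtain ⟨N, hN, hzN, θ₁, hθ₁, heq⟩ := h z hz
    rw [heq hzN]
    exact hθ₁.pos z hzN

theorem IsKahlerFormOn.mono {θ : Cn m → Cn m [⋀^Fin 2]→L[ℝ] ℝ} {Y Z : Set (Cn m)}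
    (h : IsKahlerFormOn θ Y) (hZ : Z ⊆ Y) : IsKahlerFormOn θ Z where
  smooth := h.smooth.mono hZ
  closed z hz := h.closed z (hZ hz)
  invariant z hz := h.invariant z (hZ hz)
  pos z hz := h.pos z (hZ hz)

/-- A Kähler form has a potential near `0` which vanishes there to second order. -/
theorem IsKahlerFormOn.exists_normalized_potential {θ : Cn m → Cn m [⋀^Fin 2]→L[ℝ] ℝ}
    {U : Set (Cn m)} (hU : IsOpen U) (hU0 : (0 : Cn m) ∈ U) (hθ : IsKahlerFormOn θ U) :
    ∃ R : ℝ, 0 < R ∧ Metric.ball (0 : Cn m) R ⊆ U ∧ ∃ p : Cn m → ℝ,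
      IsStrictlyPSHOn p (Metric.ball 0 R) ∧ p 0 = 0 ∧ fderiv ℝ p 0 = 0 ∧
        ∀ z ∈ Metric.ball (0 : Cn m) R, ddc p z = θ z := by
  obtain ⟨h, hh, hhθ⟩ := exists_local_potential hU hU0 hθ.smooth hθ.closed hθ.invariant
  obtain ⟨R, hR, hball⟩ := Metric.eventually_nhds_iff_ball.1 (hhθ.and (hU.mem_nhds hU0))
  -- Subtracting the first-order Taylor polynomial does not affect second derivatives, hence not
  -- `dd^c`.
  set p : Cn m → ℝ := fun z => h z - (h 0 + fderiv ℝ h 0 z) with hp_def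
  have hp : ContDiff ℝ ∞ p := hh.sub (contDiff_const.add (fderiv ℝ h 0).contDiff)
  have hdp : fderiv ℝ p = fun z => fderiv ℝ h z - fderiv ℝ h 0 := by
    ext1 z
    exact ((hh.differentiable (by simp) z).hasFDerivAt.sub
      ((fderiv ℝ h 0).hasFDerivAt.const_add (h 0))).fderiv
  have hddc : ∀ z ∈ Metric.ball (0 : Cn m) R, ddc p z = θ z := by
    intro z hz
    rw [← (hball z hz).1]
    refine form_ext fun v w => ?_
    rw [ddc_apply (hp.contDiffAt.of_le two_le_infty), ddc_apply (hh.contDiffAt.of_le two_le_infty),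
      hdp, fderiv_sub_const]
  refine ⟨R, hR, fun z hz => (hball z hz).2, p, ⟨hp.contDiffOn, fun z hz v hv => ?_⟩, ?_, ?_, hddc⟩
  · rw [hddc z hz]
    exact hθ.pos z (hball z hz).2 v hv
  · simp [hp_def]
  · simp [hdp]

theorem exists_isKahlerFormOn_eq_ddc_radius_sq {lam : Fin m → ℝ} (hlam : ∀ a, 0 < lam a)
    {U : Set (Cn m)} (hU : IsOpen U) (hU0 : (0 : Cn m) ∈ U)
    {θ : Cn m → Cn m [⋀^Fin 2]→L[ℝ] ℝ} (hθ : IsKahlerFormOn θ U) :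
    ∃ ε : ℝ, 0 < ε ∧ ∃ θ' : Cn m → Cn m [⋀^Fin 2]→L[ℝ] ℝ, IsKahlerFormOn θ' (U \ {0}) ∧
      ∃ V W : Set (Cn m), IsOpen V ∧ IsOpen W ∧ (0 : Cn m) ∈ W ∧
        closure W ⊆ V ∧ IsCompact (closure V) ∧ closure V ⊆ U ∧
        (∀ z ∈ U \ V, θ' z = θ z) ∧
        (∀ z ∈ W \ {0}, θ' z = ε • ddc (fun x => radius lam x ^ 2) z) := by
  classical
  obtain ⟨R, hR, hRU, p, hp, hp0, hdp0, hpθ⟩ := hθ.exists_normalized_potential hU hU0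
  obtain ⟨ε, hε, q, hq, V, W, -, hW, hW0, hWV, -, hVR, hqp, hqr⟩ :=
    exists_isStrictlyPSHOn_eq_radius_sq hlam Metric.isOpen_ball (Metric.mem_ball_self hR)
      hp hp0 hdp0
  -- Equality of `q` and `p` off `V` gives equality of their `dd^c` only off `closure V`, where it
  -- holds on a neighbourhood. The ball of radius `R'` contains `closure V` and replaces `V`.
  obtain ⟨R', hR'R, hVR'⟩ := exists_lt_subset_ball isClosed_closure hVR
  have hVR'' : closure (Metric.ball (0 : Cn m) R') ⊆ Metric.ball (0 : Cn m) R :=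
    Metric.closure_ball_subset_closedBall.trans (Metric.closedBall_subset_ball hR'R)
  have hWR : W ⊆ Metric.ball (0 : Cn m) R :=
    subset_closure.trans (hWV.trans (subset_closure.trans hVR))
  set θ' : Cn m → Cn m [⋀^Fin 2]→L[ℝ] ℝ :=
    fun z => if z ∈ Metric.ball (0 : Cn m) R then ddc q z else θ z with hθ'_def
  have hin : ∀ z ∈ Metric.ball (0 : Cn m) R, θ' z = ddc q z := fun z hz => if_pos hz
  have hout : ∀ z ∈ U \ closure V, θ' z = θ z := by
    rintro z ⟨-, hzV⟩
    by_cases hz : z ∈ Metric.ball (0 : Cn m) R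
    · rw [hin z hz, ← hpθ z hz]
      refine ddc_congr ?_
      filter_upwards [Metric.isOpen_ball.mem_nhds hz, isClosed_closure.isOpen_compl.mem_nhds hzV]
        with x hx hxV
      exact hqp x ⟨hx, fun h => hxV (subset_closure h)⟩
    · exact if_neg hz
  have hopen : IsOpen (Metric.ball (0 : Cn m) R \ {0}) :=
    Metric.isOpen_ball.sdiff isClosed_singleton
  refine ⟨ε, hε, θ', IsKahlerFormOn.of_locally fun z hz => ?_, Metric.ball 0 R', W,
    Metric.isOpen_ball, hW, hW0, hWV.trans (subset_closure.trans hVR'), ?_, hVR''.trans hRU, ?_, ?_⟩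
  -- The punctured ball and `U \ closure V` form an open cover of `U \ {0}`; `θ'` is `ddc q` on the
  -- former and `θ` on the latter.
  · by_cases hzR : z ∈ Metric.ball (0 : Cn m) R
    · exact ⟨_, hopen, ⟨hzR, hz.2⟩, ddc q, hq.isKahlerFormOn hopen, fun x hx => hin x hx.1⟩
    · exact ⟨U \ closure V, hU.sdiff isClosed_closure, ⟨hz.1, fun h => hzR (hVR h)⟩, θ,
        hθ.mono Set.sdiff_subset, hout⟩
  · exact (isCompact_closedBall (0 : Cn m) R').of_isClosed_subset isClosed_closure
      Metric.closure_ball_subset_closedBall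
  · exact fun z hz => hout z ⟨hz.1, fun h => hz.2 (hVR' h)⟩
  · rintro z ⟨hzW, hz0⟩
    have hopen0 : IsOpen ({0}ᶜ : Set (Cn m)) := isOpen_compl_singleton
    have heq : q =ᶠ[𝓝 z] fun x => ε * radius lam x ^ 2 := by
      filter_upwards [hW.mem_nhds hzW, hopen0.mem_nhds hz0] with x hx hx0
      exact hqr x ⟨hx, hx0⟩
    rw [hin z (hWR hzW), ddc_congr heq, ddc_const_mul]
    exact ((contDiffOn_radius_sq hlam).contDiffAt (hopen0.mem_nhds hz0)).of_le two_le_infty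

end KahlerCone

theorem lemma4p3 (m : ℕ) (hm : 1 ≤ m) (lam : Fin m → ℝ)
    (hlam : ∀ a, lam a ∈ Set.Ioo (0 : ℝ) 1)
    (U : Set (KahlerCone.Cn m)) (hU : IsOpen U) (hU0 : (0 : KahlerCone.Cn m) ∈ U) :
    (∀ p : KahlerCone.Cn m → ℝ, KahlerCone.IsStrictlyPSHOn p U → p 0 = 0 → fderiv ℝ p 0 = 0 →
      ∃ ε : ℝ, 0 < ε ∧ ∃ q : KahlerCone.Cn m → ℝ, KahlerCone.IsStrictlyPSHOn q (U \ {0}) ∧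
        ∃ V W : Set (KahlerCone.Cn m), IsOpen V ∧ IsOpen W ∧ (0 : KahlerCone.Cn m) ∈ W ∧
          closure W ⊆ V ∧ IsCompact (closure V) ∧ closure V ⊆ U ∧
          (∀ z ∈ U \ V, q z = p z) ∧
          (∀ z ∈ W \ {0}, q z = ε * KahlerCone.radius lam z ^ 2)) ∧
    (∀ θ : KahlerCone.Cn m → KahlerCone.Cn m [⋀^Fin 2]→L[ℝ] ℝ, KahlerCone.IsKahlerFormOn θ U →
      ∃ ε : ℝ, 0 < ε ∧ ∃ θ' : KahlerCone.Cn m → KahlerCone.Cn m [⋀^Fin 2]→L[ℝ] ℝ,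
        KahlerCone.IsKahlerFormOn θ' (U \ {0}) ∧
        ∃ V W : Set (KahlerCone.Cn m), IsOpen V ∧ IsOpen W ∧ (0 : KahlerCone.Cn m) ∈ W ∧
          closure W ⊆ V ∧ IsCompact (closure V) ∧ closure V ⊆ U ∧
          (∀ z ∈ U \ V, θ' z = θ z) ∧
          (∀ z ∈ W \ {0},
            θ' z = ε • KahlerCone.ddc (fun x => KahlerCone.radius lam x ^ 2) z)) :=
  ⟨fun _ hp hp0 hdp0 => KahlerCone.exists_isStrictlyPSHOn_eq_radius_sq (fun a => (hlam a).1)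
    hU hU0 hp hp0 hdp0,
  fun _ hθ => KahlerCone.exists_isKahlerFormOn_eq_ddc_radius_sq (fun a => (hlam a).1) hU hU0 hθ⟩
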